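/- **Theorem 3.1.** Let $(\mathcal M^n,g)$ be a connected smooth Riemannian manifold with positive sectional curvature that is a (steady) gradient Ricci soliton with Ricci potential $f$, i.e. $f:\mathcal M\to\mathbb R$ is smooth and $R_{ij}=\nabla_i\nabla_j f$. Assume that the scalar curvature attains its maximum at a point $\mathcal O$, that this maximum equals $1$, and that $f$ is normalized by $f(\mathcal O)=0$. Let $N=\nabla f/|\nabla f|$ be the outward unit normal to the level sets of $f$, and let $\Gamma:(0,\infty)\to\mathcal M$ be an integral curve of $\nabla f/|\nabla f|^2$, parametrized so that $f(\Gamma(\lambda))=\lambda$ for all $\lambda>0$. For $\lambda>0$ put $q=\Gamma(\lambda)$ and $s=d(\mathcal O,q)$, and for a minimizing geodesic $\gamma:[0,s]\to\mathcal M$ from $\mathcal O$ to $q$, parametrized by arc length, let $\theta(\Gamma,\gamma)$ be the angle at $q=\gamma(s)$ between $N$ and the radial direction $\gamma'(s)$. Then: 1. For every $\lambda>0$ and every minimizing geodesic $\gamma$ from $\mathcal O$ to $q=\Gamma(\lambda)$, $$|\nabla f(q)|\cos\theta(\Gamma,\gamma)\;\ge\;\frac{f(q)-f(\mathcal O)}{s}.$$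 2. The limit $\zeta_\Gamma=\lim_{\lambda\to\infty}|\nabla f(\Gamma(\lambda))|$ exists and is a positive real number, and for every $\varepsilon>0$ there is a constant $\lambda(\varepsilon)>0$ (which may depend on $\Gamma$) such that, for all $\lambda\ge\lambda(\varepsilon)$ and all minimizing geodesics $\gamma$ from $\mathcal O$ to $\Gamma(\lambda)$, $$\cos\theta(\Gamma,\gamma)\;\ge\;\frac{\zeta_\Gamma-\varepsilon}{\zeta_\Gamma}.$$ -/

import Mathlib

open Bundle
open scoped Manifold ContDiff

noncomputable section

namespace RicciSoliton

/-! ### Riemannian geometry in an open set of coordinate space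

`G` is the matrix of metric coefficients as a function of the coordinates. -/

section Coordinates

variable {n : ℕ}

/-- The partial derivative in the `i`-th coordinate direction. -/
def partialDeriv (i : Fin n) (F : EuclideanSpace ℝ (Fin n) → ℝ)
    (y : EuclideanSpace ℝ (Fin n)) : ℝ :=
  fderiv ℝ F y (EuclideanSpace.single i (1 : ℝ))

/-- The Christoffel symbol `Γ^k_{ij}` of the Levi-Civita connection:
`Γ^k_{ij} = (1/2) ∑_l g^{kl} (∂_i g_{jl} + ∂_j g_{il} - ∂_l g_{ij})`. -/
def christoffel (G : EuclideanSpace ℝ (Fin n) → Matrix (Fin n) (Fin n) ℝ)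
    (i j k : Fin n) (y : EuclideanSpace ℝ (Fin n)) : ℝ :=
  (1 / 2 : ℝ) * ∑ l, (G y)⁻¹ k l *
    (partialDeriv i (fun z => G z j l) y + partialDeriv j (fun z => G z i l) y
      - partialDeriv l (fun z => G z i j) y)

/-- The component `R^l_{ijk}` of the curvature tensor, where `R(∂_i, ∂_j) ∂_k = ∑_l R^l_{ijk} ∂_l`
and `R(X, Y) Z = ∇_X ∇_Y Z - ∇_Y ∇_X Z - ∇_{[X, Y]} Z`. -/
def riemann (G : EuclideanSpace ℝ (Fin n) → Matrix (Fin n) (Fin n) ℝ)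
    (i j k l : Fin n) (y : EuclideanSpace ℝ (Fin n)) : ℝ :=
  partialDeriv i (christoffel G j k l) y - partialDeriv j (christoffel G i k l) y
    + ∑ m, (christoffel G j k m y * christoffel G i m l y
      - christoffel G i k m y * christoffel G j m l y)

/-- The Ricci tensor `Ric(∂_j, ∂_k)`, the trace of `X ↦ R(X, ∂_j) ∂_k`. -/
def ricci (G : EuclideanSpace ℝ (Fin n) → Matrix (Fin n) (Fin n) ℝ)
    (j k : Fin n) (y : EuclideanSpace ℝ (Fin n)) : ℝ :=
  ∑ i, riemann G i j k i y

/-- The scalar curvature, the trace of the Ricci tensor with respect to the metric. -/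
def scalar (G : EuclideanSpace ℝ (Fin n) → Matrix (Fin n) (Fin n) ℝ)
    (y : EuclideanSpace ℝ (Fin n)) : ℝ :=
  ∑ j, ∑ k, (G y)⁻¹ j k * ricci G j k y

/-- The scalar product of two vectors given by their components at the point `y`. -/
def metricForm (G : EuclideanSpace ℝ (Fin n) → Matrix (Fin n) (Fin n) ℝ)
    (y u v : EuclideanSpace ℝ (Fin n)) : ℝ :=
  ∑ i, ∑ j, G y i j * u i * v j

/-- `⟨R(u, v) v, u⟩` for two vectors given by their components at the point `y`. -/
def curvatureForm (G : EuclideanSpace ℝ (Fin n) → Matrix (Fin n) (Fin n) ℝ)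
    (y u v : EuclideanSpace ℝ (Fin n)) : ℝ :=
  ∑ i, ∑ j, ∑ k, ∑ l, ∑ m, G y l m * riemann G i j k l y * u i * v j * v k * u m

/-- The sectional curvature of the plane spanned by two linearly independent vectors. -/
def sectional (G : EuclideanSpace ℝ (Fin n) → Matrix (Fin n) (Fin n) ℝ)
    (y u v : EuclideanSpace ℝ (Fin n)) : ℝ :=
  curvatureForm G y u v /
    (metricForm G y u u * metricForm G y v v - metricForm G y u v ^ 2)

/-- The covariant Hessian `∇_i ∇_j F = ∂_i ∂_j F - ∑_k Γ^k_{ij} ∂_k F`. -/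
def hessian (G : EuclideanSpace ℝ (Fin n) → Matrix (Fin n) (Fin n) ℝ)
    (F : EuclideanSpace ℝ (Fin n) → ℝ) (i j : Fin n) (y : EuclideanSpace ℝ (Fin n)) : ℝ :=
  partialDeriv i (partialDeriv j F) y - ∑ k, christoffel G i j k y * partialDeriv k F y

end Coordinates

/-! ### Riemannian manifolds -/

section Manifold

variable {n : ℕ} {M : Type*} [MetricSpace M] [ChartedSpace (EuclideanSpace ℝ (Fin n)) M]
  [RiemannianBundle (fun x : M => TangentSpace (𝓡 n) x)]

/-- The metric coefficients `g_{ij} = ⟨∂_i, ∂_j⟩` in the chart `φ`, as functions of the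
coordinates; `∂_i` is the image of the `i`-th unit vector under the differential of `φ⁻¹`. -/
def metricCoeff (φ : OpenPartialHomeomorph M (EuclideanSpace ℝ (Fin n)))
    (y : EuclideanSpace ℝ (Fin n)) : Matrix (Fin n) (Fin n) ℝ :=
  Matrix.of fun i j =>
    inner ℝ
      (mfderiv (𝓡 n) (𝓡 n) φ.symm y (EuclideanSpace.single i (1 : ℝ)) :
        TangentSpace (𝓡 n) (φ.symm y))
      (mfderiv (𝓡 n) (𝓡 n) φ.symm y (EuclideanSpace.single j (1 : ℝ)) :
        TangentSpace (𝓡 n) (φ.symm y))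

variable (n) in
/-- The scalar curvature of `M` at the point `x` (the value does not depend on the chart). -/
def scalarCurvature (x : M) : ℝ :=
  scalar (metricCoeff (chartAt (EuclideanSpace ℝ (Fin n)) x))
    (chartAt (EuclideanSpace ℝ (Fin n)) x x)

variable (n M) in
/-- All sectional curvatures of `M` are positive. -/
def HasPositiveSectionalCurvature : Prop :=
  ∀ φ ∈ IsManifold.maximalAtlas (𝓡 n) ∞ M, ∀ y ∈ φ.target,
    ∀ u v : EuclideanSpace ℝ (Fin n), LinearIndependent ℝ ![u, v] →
      0 < sectional (metricCoeff φ) y u v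

variable (n) in
/-- `M` is a (steady) gradient Ricci soliton with Ricci potential `f`: the function `f` is smooth
and `R_{ij} = ∇_i ∇_j f`. -/
structure IsGradientRicciSoliton (f : M → ℝ) : Prop where
  smooth : ContMDiff (𝓡 n) 𝓘(ℝ, ℝ) ∞ f
  ricci_eq : ∀ φ ∈ IsManifold.maximalAtlas (𝓡 n) ∞ M, ∀ y ∈ φ.target, ∀ i j : Fin n,
    ricci (metricCoeff φ) i j y = hessian (metricCoeff φ) (fun z => f (φ.symm z)) i j y

variable (n) in
/-- The Riemannian gradient `∇f`: the tangent vector with `⟨∇f, v⟩ = df(v)` for all `v`. -/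
def grad (f : M → ℝ) (x : M) : TangentSpace (𝓡 n) x :=
  haveI : FiniteDimensional ℝ (TangentSpace (𝓡 n) x) :=
    inferInstanceAs (FiniteDimensional ℝ (EuclideanSpace ℝ (Fin n)))
  haveI : CompleteSpace (TangentSpace (𝓡 n) x) := FiniteDimensional.complete ℝ _
  (InnerProductSpace.toDual ℝ (TangentSpace (𝓡 n) x)).symm (mfderiv (𝓡 n) 𝓘(ℝ, ℝ) f x)

/-- The defining property of the gradient. -/
theorem inner_grad (f : M → ℝ) (x : M) (v : TangentSpace (𝓡 n) x) :
    inner ℝ (grad n f x) v = mfderiv (𝓡 n) 𝓘(ℝ, ℝ) f x v := by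
  have : FiniteDimensional ℝ (TangentSpace (𝓡 n) x) :=
    inferInstanceAs (FiniteDimensional ℝ (EuclideanSpace ℝ (Fin n)))
  have : CompleteSpace (TangentSpace (𝓡 n) x) := FiniteDimensional.complete ℝ _
  exact InnerProductSpace.toDual_symm_apply

variable (n) in
/-- The outward unit normal `N = ∇f / |∇f|` to the level sets of `f`. -/
def normal (f : M → ℝ) (x : M) : TangentSpace (𝓡 n) x :=
  ‖grad n f x‖⁻¹ • grad n f x

variable (n) in
/-- The vector field `∇f / |∇f|²`. -/
def levelField (f : M → ℝ) (x : M) : TangentSpace (𝓡 n) x :=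
  (‖grad n f x‖ ^ 2)⁻¹ • grad n f x

variable (n) in
/-- The velocity vector of a curve. -/
def velocity (γ : ℝ → M) (t : ℝ) : TangentSpace (𝓡 n) (γ t) :=
  mfderiv 𝓘(ℝ, ℝ) (𝓡 n) γ t (1 : ℝ)

variable (n) in
/-- The curve `γ` satisfies the geodesic equation
`(γ^k)'' + ∑_{i,j} Γ^k_{ij} (γ^i)' (γ^j)' = 0` at time `t`. -/
def GeodesicEquationAt (γ : ℝ → M) (t : ℝ) : Prop :=
  ∀ φ ∈ IsManifold.maximalAtlas (𝓡 n) ∞ M, γ t ∈ φ.source → ∀ k : Fin n,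
    deriv (deriv fun τ => φ (γ τ) k) t
      + ∑ i, ∑ j, christoffel (metricCoeff φ) i j k (φ (γ t))
        * deriv (fun τ => φ (γ τ) i) t * deriv (fun τ => φ (γ τ) j) t = 0

variable (n) in
/-- On the interval `[0, d(p, q)]`, the curve `γ` is a minimizing geodesic from `p` to `q`,
parametrized by arc length, so that its length is equal to the distance of its endpoints. -/
structure IsMinimizingGeodesic (γ : ℝ → M) (p q : M) : Prop where
  smooth : ∀ t ∈ Set.Icc 0 (dist p q), ContMDiffAt 𝓘(ℝ, ℝ) (𝓡 n) ∞ γ t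
  geodesic : ∀ t ∈ Set.Icc 0 (dist p q), GeodesicEquationAt n γ t
  unit_speed : ∀ t ∈ Set.Icc 0 (dist p q), ‖velocity n γ t‖ = 1
  source : γ 0 = p
  target : γ (dist p q) = q

variable (n) in
/-- The angle at the point `γ t` between the outward unit normal `N` and the velocity of `γ`. -/
def normalAngle (f : M → ℝ) (γ : ℝ → M) (t : ℝ) : ℝ :=
  InnerProductGeometry.angle (normal n f (γ t)) (velocity n γ t)

variable (n) in
/-- `Γ : (0, ∞) → M` is an integral curve of `∇f / |∇f|²`, parametrized by the values of `f`. -/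
structure IsLevelCurve (f : M → ℝ) (Γ : ℝ → M) : Prop where
  integral : IsMIntegralCurveOn (I := 𝓡 n) Γ (levelField n f) (Set.Ioi 0)
  level : ∀ l : ℝ, 0 < l → f (Γ l) = l

end Manifold

end RicciSoliton

end

/-! Along a unit-speed geodesic, `(f ∘ γ)'' = Hess f (γ', γ') = Ric (γ', γ') ≥ 0`, because positive
sectional curvature makes the Ricci form nonnegative. So `f ∘ γ` is convex, and its slope at the far
end, which is `⟨∇f, γ'⟩ = |∇f| cos θ`, is at least its mean slope. This is the first claim
(`IsGradientRicciSoliton.div_dist_le`).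

For the second claim, the contracted Bianchi identity and the soliton equation give `∇R = -2 Ric
(∇f)`, while `∇|∇f|² = 2 Ric (∇f)`. Along `Γ` the quantity `|∇f|²` therefore increases at the rate
`2 Ric (∇f, ∇f) / |∇f|² ≥ 0`, and `R + |∇f|²` is constant (`IsLevelCurve.exists_hasDerivAt`). Since
`R ≥ 0`, `|∇f|` is monotone and bounded, so it converges to some `ζ > 0`. The speed of `Γ` is `1 /
|∇f|`, so once `|∇f| ≥ κ` with `κ` close to `ζ`, the distance from `O` grows at most like `l / κ`
(`IsLevelCurve.dist_le`). Combined with `l / s ≤ |∇f| cos θ ≤ ζ cos θ` this gives the bound for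
large `l`.

Pointwise tensor identities are checked only at the centre of a chart where the metric is Euclidean
to first order (`exists_normal_chart`). The invariance needed is that of the scalar curvature, whose
definition fixes a chart; on a soliton it is the Laplacian of `f`, so invariance of the Laplacian
(`laplacian_pullback`) suffices. -/

noncomputable section

namespace RicciSoliton

/-! ### Calculus of partial derivatives for functions smooth near a point. -/

section Calculus

variable {n : ℕ}

/-- `F` is smooth in a neighbourhood of `y`. -/
def SmoothNear (F : EuclideanSpace ℝ (Fin n) → ℝ) (y : EuclideanSpace ℝ (Fin n)) : Prop :=
  ∀ᶠ z in nhds y, ContDiffAt ℝ ∞ F z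

variable {F H : EuclideanSpace ℝ (Fin n) → ℝ} {y : EuclideanSpace ℝ (Fin n)} {ι : Type*}

theorem SmoothNear.self (hF : SmoothNear F y) : ContDiffAt ℝ ∞ F y := Filter.Eventually.self_of_nhds hF

theorem SmoothNear.differentiableAt (hF : SmoothNear F y) : DifferentiableAt ℝ F y :=
  hF.self.differentiableAt (by simp)

theorem SmoothNear.eventually (hF : SmoothNear F y) : ∀ᶠ z in nhds y, SmoothNear F z :=
  eventually_eventually_nhds.2 hF

theorem SmoothNear.eventually_differentiableAt (hF : SmoothNear F y) :
    ∀ᶠ z in nhds y, DifferentiableAt ℝ F z :=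
  hF.eventually.mono fun _ h => h.differentiableAt

theorem smoothNear_const (c : ℝ) : SmoothNear (fun _ => c) y :=
  Filter.Eventually.of_forall fun _ => contDiffAt_const

theorem SmoothNear.add (hF : SmoothNear F y) (hH : SmoothNear H y) :
    SmoothNear (fun z => F z + H z) y := by
  filter_upwards [hF, hH] with z h1 h2 using h1.add h2

theorem SmoothNear.sub (hF : SmoothNear F y) (hH : SmoothNear H y) :
    SmoothNear (fun z => F z - H z) y := by
  filter_upwards [hF, hH] with z h1 h2 using h1.sub h2

theorem SmoothNear.mul (hF : SmoothNear F y) (hH : SmoothNear H y) :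
    SmoothNear (fun z => F z * H z) y := by
  filter_upwards [hF, hH] with z h1 h2 using h1.mul h2

theorem SmoothNear.inv (hF : SmoothNear F y) (h0 : F y ≠ 0) :
    SmoothNear (fun z => (F z)⁻¹) y := by
  filter_upwards [hF, hF.self.continuousAt.eventually_ne h0] with z h1 h2 using h1.inv h2

theorem SmoothNear.sum {A : ι → EuclideanSpace ℝ (Fin n) → ℝ} {s : Finset ι}
    (h : ∀ i ∈ s, SmoothNear (A i) y) : SmoothNear (fun z => ∑ i ∈ s, A i z) y := by
  have h' : ∀ᶠ z in nhds y, ∀ i ∈ s, ContDiffAt ℝ ∞ (A i) z :=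
    (Filter.eventually_all_finset s).2 h
  filter_upwards [h'] with z hz using ContDiffAt.sum hz

theorem SmoothNear.prod {A : ι → EuclideanSpace ℝ (Fin n) → ℝ} {s : Finset ι}
    (h : ∀ i ∈ s, SmoothNear (A i) y) : SmoothNear (fun z => ∏ i ∈ s, A i z) y := by
  have h' : ∀ᶠ z in nhds y, ∀ i ∈ s, ContDiffAt ℝ ∞ (A i) z :=
    (Filter.eventually_all_finset s).2 h
  filter_upwards [h'] with z hz using contDiffAt_prod hz

theorem SmoothNear.partialDeriv (hF : SmoothNear F y) (i : Fin n) :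
    SmoothNear (partialDeriv i F) y := by
  filter_upwards [hF] with z hz
  exact (hz.fderiv_right (m := ∞) (by simp)).clm_apply contDiffAt_const

theorem partialDeriv_congr (h : F =ᶠ[nhds y] H) (i : Fin n) :
    partialDeriv i F y = partialDeriv i H y := by
  simp only [partialDeriv, h.fderiv_eq]

theorem partialDeriv_congr_nhds (h : F =ᶠ[nhds y] H) (i : Fin n) :
    partialDeriv i F =ᶠ[nhds y] partialDeriv i H :=
  h.eventuallyEq_nhds.mono fun _ hz => partialDeriv_congr hz i

@[simp]
theorem partialDeriv_const (i : Fin n) (c : ℝ) : partialDeriv i (fun _ => c) y = 0 := by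
  simp [partialDeriv]

theorem partialDeriv_add (hF : DifferentiableAt ℝ F y) (hH : DifferentiableAt ℝ H y) (i : Fin n) :
    partialDeriv i (fun z => F z + H z) y = partialDeriv i F y + partialDeriv i H y := by
  simp [partialDeriv, fderiv_fun_add hF hH]

theorem partialDeriv_sub (hF : DifferentiableAt ℝ F y) (hH : DifferentiableAt ℝ H y) (i : Fin n) :
    partialDeriv i (fun z => F z - H z) y = partialDeriv i F y - partialDeriv i H y := by
  simp [partialDeriv, fderiv_fun_sub hF hH]

theorem partialDeriv_mul (hF : DifferentiableAt ℝ F y) (hH : DifferentiableAt ℝ H y) (i : Fin n) :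
    partialDeriv i (fun z => F z * H z) y
      = partialDeriv i F y * H y + F y * partialDeriv i H y := by
  simp [partialDeriv, fderiv_fun_mul hF hH]
  ring

theorem partialDeriv_const_mul (hF : DifferentiableAt ℝ F y) (c : ℝ) (i : Fin n) :
    partialDeriv i (fun z => c * F z) y = c * partialDeriv i F y := by
  rw [partialDeriv_mul (differentiableAt_const c) hF]
  simp

theorem partialDeriv_sum {A : ι → EuclideanSpace ℝ (Fin n) → ℝ} {s : Finset ι}
    (h : ∀ j ∈ s, DifferentiableAt ℝ (A j) y) (i : Fin n) :
    partialDeriv i (fun z => ∑ j ∈ s, A j z) y = ∑ j ∈ s, partialDeriv i (A j) y := by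
  simp [partialDeriv, fderiv_fun_sum h]

theorem partialDeriv_comm (hF : SmoothNear F y) (i j : Fin n) :
    partialDeriv i (partialDeriv j F) y = partialDeriv j (partialDeriv i F) y := by
  have hd : DifferentiableAt ℝ (fderiv ℝ F) y :=
    (hF.self.fderiv_right (m := ∞) (by simp)).differentiableAt (by simp)
  have hs : IsSymmSndFDerivAt ℝ F y :=
    hF.self.isSymmSndFDerivAt (by
      rw [minSmoothness_of_isRCLikeNormedField]
      exact WithTop.coe_le_coe.2 le_top)
  have key : ∀ a b : Fin n, partialDeriv a (partialDeriv b F) y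
      = fderiv ℝ (fderiv ℝ F) y (EuclideanSpace.single a 1) (EuclideanSpace.single b 1) := by
    intro a b
    have : partialDeriv b F = fun z => fderiv ℝ F z (EuclideanSpace.single b 1) := rfl
    rw [this, partialDeriv, fderiv_clm_apply hd (differentiableAt_const _)]
    simp
  rw [key, key]
  exact hs _ _

theorem fderiv_eq_sum_partialDeriv (v : EuclideanSpace ℝ (Fin n)) :
    fderiv ℝ F y v = ∑ i, v i * partialDeriv i F y := by
  have : v = ∑ i, v i • EuclideanSpace.single i (1 : ℝ) := by
    ext j
    simp [Finset.sum_apply, Pi.single_apply]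
  conv_lhs => rw [this]
  simp [partialDeriv]

/-- The second derivative of a product at a common zero of `H` and of the differential of `F`. -/
theorem partialDeriv_partialDeriv_mul (hF : SmoothNear F y) (hH : SmoothNear H y)
    (hH0 : H y = 0) (hF0 : ∀ i, partialDeriv i F y = 0) (i j : Fin n) :
    partialDeriv i (partialDeriv j fun z => F z * H z) y
      = F y * partialDeriv i (partialDeriv j H) y := by
  have h1 : partialDeriv j (fun z => F z * H z) =ᶠ[nhds y]
      fun z => partialDeriv j F z * H z + F z * partialDeriv j H z := by
    filter_upwards [hF.eventually_differentiableAt, hH.eventually_differentiableAt] with z a b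
      using partialDeriv_mul a b j
  rw [partialDeriv_congr h1, partialDeriv_add ((hF.partialDeriv j).mul hH).differentiableAt
    (hF.mul (hH.partialDeriv j)).differentiableAt,
    partialDeriv_mul (hF.partialDeriv j).differentiableAt hH.differentiableAt,
    partialDeriv_mul hF.differentiableAt (hH.partialDeriv j).differentiableAt]
  simp [hH0, hF0]

end Calculus

/-! ### Smoothness of the inverse metric and of the curvature. -/

section Inverse

variable {n : ℕ} {G : EuclideanSpace ℝ (Fin n) → Matrix (Fin n) (Fin n) ℝ}
  {y : EuclideanSpace ℝ (Fin n)}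

theorem smoothNear_det {m : ℕ} {A : EuclideanSpace ℝ (Fin n) → Matrix (Fin m) (Fin m) ℝ}
    (hA : ∀ i j, SmoothNear (fun z => A z i j) y) : SmoothNear (fun z => (A z).det) y := by
  simp only [Matrix.det_apply']
  exact SmoothNear.sum fun σ _ => (smoothNear_const _).mul (SmoothNear.prod fun i _ => hA _ _)

/-- Cramer's rule: adjugate entries are determinants of matrices with one row replaced by constants,
so smoothness of determinants is enough. -/
theorem smoothNear_inv (hG : ∀ i j, SmoothNear (fun z => G z i j) y) (h0 : (G y).det ≠ 0)
    (i j : Fin n) : SmoothNear (fun z => (G z)⁻¹ i j) y := by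
  have : (fun z => (G z)⁻¹ i j) = fun z => ((G z).det)⁻¹ * (G z).adjugate i j := by
    ext z
    simp [Matrix.inv_def, Ring.inverse_eq_inv']
  rw [this]
  refine ((smoothNear_det hG).inv h0).mul ?_
  simp only [Matrix.adjugate_apply]
  refine smoothNear_det fun a b => ?_
  simp only [Matrix.updateRow_apply]
  split_ifs
  · exact smoothNear_const _
  · exact hG a b

theorem smoothNear_christoffel (hG : ∀ i j, SmoothNear (fun z => G z i j) y)
    (h0 : (G y).det ≠ 0) (i j k : Fin n) : SmoothNear (christoffel G i j k) y := by
  refine (smoothNear_const _).mul (SmoothNear.sum fun l _ => (smoothNear_inv hG h0 k l).mul ?_)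
  exact (((hG j l).partialDeriv i).add ((hG i l).partialDeriv j)).sub ((hG i j).partialDeriv l)

theorem smoothNear_riemann (hG : ∀ i j, SmoothNear (fun z => G z i j) y)
    (h0 : (G y).det ≠ 0) (i j k l : Fin n) : SmoothNear (riemann G i j k l) y := by
  have hc := fun a b c => smoothNear_christoffel hG h0 a b c
  exact (((hc _ _ _).partialDeriv i).sub ((hc _ _ _).partialDeriv j)).add
    (SmoothNear.sum fun m _ => ((hc _ _ _).mul (hc _ _ _)).sub ((hc _ _ _).mul (hc _ _ _)))

theorem smoothNear_ricci (hG : ∀ i j, SmoothNear (fun z => G z i j) y)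
    (h0 : (G y).det ≠ 0) (j k : Fin n) : SmoothNear (ricci G j k) y :=
  SmoothNear.sum fun _ _ => smoothNear_riemann hG h0 _ _ _ _

theorem smoothNear_scalar (hG : ∀ i j, SmoothNear (fun z => G z i j) y)
    (h0 : (G y).det ≠ 0) : SmoothNear (scalar G) y :=
  SmoothNear.sum fun _ _ => SmoothNear.sum fun _ _ =>
    (smoothNear_inv hG h0 _ _).mul (smoothNear_ricci hG h0 _ _)

end Inverse

/-! ### Tensor identities at the centre of normal coordinates. -/

section NormalCoordinates

variable {n : ℕ}

/-- The coefficients `G` are smooth and symmetric near `y`, and to first order at `y` they are the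
Euclidean ones. -/
structure IsNormalAt (G : EuclideanSpace ℝ (Fin n) → Matrix (Fin n) (Fin n) ℝ)
    (y : EuclideanSpace ℝ (Fin n)) : Prop where
  smooth : ∀ i j, SmoothNear (fun z => G z i j) y
  symm : ∀ᶠ z in nhds y, ∀ i j, G z i j = G z j i
  eq_one : G y = 1
  deriv_eq_zero : ∀ l i j, partialDeriv l (fun z => G z i j) y = 0

namespace IsNormalAt

variable {G : EuclideanSpace ℝ (Fin n) → Matrix (Fin n) (Fin n) ℝ}
  {y : EuclideanSpace ℝ (Fin n)} (h : IsNormalAt G y)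
include h

theorem det_ne_zero : (G y).det ≠ 0 := by simp [h.eq_one]

theorem smooth_inv (i j : Fin n) : SmoothNear (fun z => (G z)⁻¹ i j) y :=
  smoothNear_inv h.smooth h.det_ne_zero i j

theorem inv_eq_one : (G y)⁻¹ = 1 := by simp [h.eq_one]

/-- Differentiate `G⁻¹ G = 1` at a point where `G = 1` and the first derivatives of `G` vanish. -/
theorem partialDeriv_inv (l i j : Fin n) : partialDeriv l (fun z => (G z)⁻¹ i j) y = 0 := by
  have hdet : ∀ᶠ z in nhds y, (G z).det ≠ 0 :=
    (smoothNear_det h.smooth).self.continuousAt.eventually_ne h.det_ne_zero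
  have h1 : (fun z => ∑ k, (G z)⁻¹ i k * G z k j) =ᶠ[nhds y]
      fun _ => (1 : Matrix (Fin n) (Fin n) ℝ) i j := by
    filter_upwards [hdet] with z hz
    rw [← Matrix.mul_apply, Matrix.nonsing_inv_mul _ (isUnit_iff_ne_zero.2 hz)]
  have h2 := partialDeriv_congr h1 l
  rw [partialDeriv_const, partialDeriv_sum fun k _ =>
    ((h.smooth_inv i k).mul (h.smooth k j)).differentiableAt] at h2
  simp_rw [fun k => partialDeriv_mul (h.smooth_inv i k).differentiableAt
    (h.smooth k j).differentiableAt l, h.deriv_eq_zero, h.eq_one] at h2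
  simpa [Matrix.one_apply] using h2

theorem christoffel_eq_zero (i j k : Fin n) : christoffel G i j k y = 0 := by
  simp [christoffel, h.deriv_eq_zero]

/-- The first derivatives of the Christoffel symbols at the centre. -/
theorem partialDeriv_christoffel (a i j k : Fin n) :
    partialDeriv a (christoffel G i j k) y
      = (1 / 2) * (partialDeriv a (partialDeriv i fun z => G z j k) y
        + partialDeriv a (partialDeriv j fun z => G z i k) y
        - partialDeriv a (partialDeriv k fun z => G z i j) y) := by
  have hK : ∀ l, SmoothNear (fun z => partialDeriv i (fun z => G z j l) z
      + partialDeriv j (fun z => G z i l) z - partialDeriv l (fun z => G z i j) z) y := fun l =>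
    (((h.smooth j l).partialDeriv i).add ((h.smooth i l).partialDeriv j)).sub
      ((h.smooth i j).partialDeriv l)
  have e : christoffel G i j k = fun z => (1 / 2 : ℝ) * ∑ l, (G z)⁻¹ k l *
    (partialDeriv i (fun z => G z j l) z + partialDeriv j (fun z => G z i l) z
      - partialDeriv l (fun z => G z i j) z) := rfl
  rw [e, partialDeriv_const_mul (SmoothNear.sum fun l _ =>
    (h.smooth_inv k l).mul (hK l)).differentiableAt,
    partialDeriv_sum fun l _ => ((h.smooth_inv k l).mul (hK l)).differentiableAt]
  simp_rw [fun l => partialDeriv_mul (h.smooth_inv k l).differentiableAt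
    (hK l).differentiableAt a, h.partialDeriv_inv, h.inv_eq_one, Matrix.one_apply]
  simp only [zero_mul, zero_add, ite_mul, one_mul, Finset.sum_ite_eq, Finset.mem_univ, if_true]
  rw [partialDeriv_sub (((h.smooth j k).partialDeriv i).add
    ((h.smooth i k).partialDeriv j)).differentiableAt
    ((h.smooth i j).partialDeriv k).differentiableAt,
    partialDeriv_add ((h.smooth j k).partialDeriv i).differentiableAt
    ((h.smooth i k).partialDeriv j).differentiableAt]

/-- At the centre both the bracket of first derivatives of `G` and the differential of `G⁻¹` vanish,
so only the term with both derivatives on the bracket survives. -/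
theorem partialDeriv_partialDeriv_christoffel (a b i j k : Fin n) :
    partialDeriv a (partialDeriv b (christoffel G i j k)) y
      = (1 / 2) * (partialDeriv a (partialDeriv b (partialDeriv i fun z => G z j k)) y
        + partialDeriv a (partialDeriv b (partialDeriv j fun z => G z i k)) y
        - partialDeriv a (partialDeriv b (partialDeriv k fun z => G z i j)) y) := by
  have hK : ∀ l, SmoothNear (fun z => partialDeriv i (fun z => G z j l) z
      + partialDeriv j (fun z => G z i l) z - partialDeriv l (fun z => G z i j) z) y := fun l =>
    (((h.smooth j l).partialDeriv i).add ((h.smooth i l).partialDeriv j)).sub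
      ((h.smooth i j).partialDeriv l)
  have hm := fun l => (h.smooth_inv k l).mul (hK l)
  have e1 : partialDeriv b (christoffel G i j k) =ᶠ[nhds y] fun z =>
      (1 / 2 : ℝ) * ∑ l, partialDeriv b (fun z => (G z)⁻¹ k l *
        (partialDeriv i (fun z => G z j l) z + partialDeriv j (fun z => G z i l) z
        - partialDeriv l (fun z => G z i j) z)) z := by
    filter_upwards [(Filter.eventually_all.2 hm : ∀ᶠ z in nhds y, ∀ l, _)] with z hz
    rw [← partialDeriv_sum fun l _ => (hz l).differentiableAt (by simp),
      ← partialDeriv_const_mul (DifferentiableAt.fun_sum fun l _ =>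
        (hz l).differentiableAt (by simp))]
    rfl
  rw [partialDeriv_congr e1, partialDeriv_const_mul (SmoothNear.sum fun l _ =>
    (hm l).partialDeriv b).differentiableAt,
    partialDeriv_sum fun l _ => ((hm l).partialDeriv b).differentiableAt]
  simp_rw [fun l => partialDeriv_partialDeriv_mul (h.smooth_inv k l) (hK l)
    (by simp [h.deriv_eq_zero]) (fun c => h.partialDeriv_inv c k l) a b, h.inv_eq_one,
    Matrix.one_apply]
  simp only [zero_mul, ite_mul, one_mul, Finset.sum_ite_eq, Finset.mem_univ, if_true]
  have e2 : partialDeriv b (fun z => partialDeriv i (fun z => G z j k) z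
      + partialDeriv j (fun z => G z i k) z - partialDeriv k (fun z => G z i j) z) =ᶠ[nhds y]
      fun z => partialDeriv b (partialDeriv i fun z => G z j k) z
        + partialDeriv b (partialDeriv j fun z => G z i k) z
        - partialDeriv b (partialDeriv k fun z => G z i j) z := by
    filter_upwards [((h.smooth j k).partialDeriv i).eventually_differentiableAt,
      ((h.smooth i k).partialDeriv j).eventually_differentiableAt,
      ((h.smooth i j).partialDeriv k).eventually_differentiableAt] with z h1 h2 h3
    rw [partialDeriv_sub (h1.fun_add h2) h3, partialDeriv_add h1 h2]
  rw [partialDeriv_congr e2, partialDeriv_sub ((((h.smooth j k).partialDeriv i).partialDeriv b).add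
    (((h.smooth i k).partialDeriv j).partialDeriv b)).differentiableAt
    (((h.smooth i j).partialDeriv k).partialDeriv b).differentiableAt,
    partialDeriv_add (((h.smooth j k).partialDeriv i).partialDeriv b).differentiableAt
    (((h.smooth i k).partialDeriv j).partialDeriv b).differentiableAt]

theorem riemann_eq (i j k l : Fin n) : riemann G i j k l y
    = partialDeriv i (christoffel G j k l) y - partialDeriv j (christoffel G i k l) y := by
  simp [riemann, h.christoffel_eq_zero]

/-- The terms quadratic in the Christoffel symbols have zero derivative, since both factors vanish
at the centre. -/
theorem partialDeriv_riemann (m i j k l : Fin n) : partialDeriv m (riemann G i j k l) y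
    = partialDeriv m (partialDeriv i (christoffel G j k l)) y
      - partialDeriv m (partialDeriv j (christoffel G i k l)) y := by
  have hc := fun a b c => smoothNear_christoffel h.smooth h.det_ne_zero a b c
  have hd := fun a b c => (hc a b c).differentiableAt
  have e : riemann G i j k l = fun y =>
    partialDeriv i (christoffel G j k l) y - partialDeriv j (christoffel G i k l) y
    + ∑ m, (christoffel G j k m y * christoffel G i m l y
      - christoffel G i k m y * christoffel G j m l y) := rfl
  rw [e, partialDeriv_add (((hc _ _ _).partialDeriv i).sub
      ((hc _ _ _).partialDeriv j)).differentiableAt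
    (SmoothNear.sum fun m _ =>
      ((hc _ _ _).mul (hc _ _ _)).sub ((hc _ _ _).mul (hc _ _ _))).differentiableAt,
    partialDeriv_sub ((hc _ _ _).partialDeriv i).differentiableAt
      ((hc _ _ _).partialDeriv j).differentiableAt,
    partialDeriv_sum fun m _ =>
      (((hc _ _ _).mul (hc _ _ _)).sub ((hc _ _ _).mul (hc _ _ _))).differentiableAt]
  rw [add_eq_left]
  refine Finset.sum_eq_zero fun a _ => ?_
  rw [partialDeriv_sub ((hd _ _ _).fun_mul (hd _ _ _)) ((hd _ _ _).fun_mul (hd _ _ _)),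
    partialDeriv_mul (hd _ _ _) (hd _ _ _), partialDeriv_mul (hd _ _ _) (hd _ _ _)]
  simp [h.christoffel_eq_zero]

theorem partialDeriv_ricci (m j k : Fin n) : partialDeriv m (ricci G j k) y
    = ∑ i, (partialDeriv m (partialDeriv i (christoffel G j k i)) y
      - partialDeriv m (partialDeriv j (christoffel G i k i)) y) := by
  have e : ricci G j k = fun y => ∑ i, riemann G i j k i y := rfl
  rw [e, partialDeriv_sum fun i _ =>
    (smoothNear_riemann h.smooth h.det_ne_zero _ _ _ _).differentiableAt]
  exact Finset.sum_congr rfl fun i _ => h.partialDeriv_riemann m i j k i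

theorem partialDeriv_scalar (m : Fin n) : partialDeriv m (scalar G) y
    = ∑ j, partialDeriv m (ricci G j j) y := by
  have hr := fun j k => smoothNear_ricci h.smooth h.det_ne_zero j k
  have hm := fun j k => (h.smooth_inv j k).mul (hr j k)
  have e : scalar G = fun y => ∑ j, ∑ k, (G y)⁻¹ j k * ricci G j k y := rfl
  rw [e, partialDeriv_sum fun j _ => (SmoothNear.sum fun k _ => hm j k).differentiableAt]
  refine Finset.sum_congr rfl fun j _ => ?_
  rw [partialDeriv_sum fun k _ => (hm j k).differentiableAt]
  simp_rw [fun k => partialDeriv_mul (h.smooth_inv j k).differentiableAt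
    (hr j k).differentiableAt m, h.partialDeriv_inv, h.inv_eq_one, Matrix.one_apply]
  simp

theorem partialDeriv_symm (a b i j : Fin n) :
    partialDeriv a (partialDeriv b fun z => G z i j) y
      = partialDeriv a (partialDeriv b fun z => G z j i) y :=
  partialDeriv_congr (partialDeriv_congr_nhds (h.symm.mono fun _ hz => hz i j) b) a

theorem partialDeriv_symm₃ (a b c i j : Fin n) :
    partialDeriv a (partialDeriv b (partialDeriv c fun z => G z i j)) y
      = partialDeriv a (partialDeriv b (partialDeriv c fun z => G z j i)) y :=
  partialDeriv_congr (partialDeriv_congr_nhds (partialDeriv_congr_nhds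
    (h.symm.mono fun _ hz => hz i j) c) b) a

theorem partialDeriv_comm₃ (a b c i j : Fin n) :
    partialDeriv a (partialDeriv b (partialDeriv c fun z => G z i j)) y
      = partialDeriv a (partialDeriv c (partialDeriv b fun z => G z i j)) y :=
  partialDeriv_congr ((h.smooth i j).eventually.mono fun _ hz => partialDeriv_comm hz b c) a

/-- The contracted second Bianchi identity. -/
theorem sum_partialDeriv_ricci (m : Fin n) :
    ∑ j, partialDeriv j (ricci G m j) y = (1 / 2) * partialDeriv m (scalar G) y := by
  rw [h.partialDeriv_scalar]
  simp_rw [h.partialDeriv_ricci, h.partialDeriv_partialDeriv_christoffel]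
  have c1 : ∀ a b c i j : Fin n,
      partialDeriv a (partialDeriv b (partialDeriv c fun z => G z i j)) y
      = partialDeriv b (partialDeriv a (partialDeriv c fun z => G z i j)) y := fun a b c i j =>
    partialDeriv_comm ((h.smooth i j).partialDeriv c) a b
  have c2 := h.partialDeriv_comm₃
  have s := h.partialDeriv_symm₃
  -- Everything is now linear in the third derivatives of the metric. Treating them as an abstract
  -- array, the identity follows from symmetry in the derivative indices and in the metric indices,
  -- plus relabelling of sums.
  set D : Fin n → Fin n → Fin n → Fin n → Fin n → ℝ := fun a b c i j =>
    partialDeriv a (partialDeriv b (partialDeriv c fun z => G z i j)) y with hD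
  change ∑ j, ∑ i, ((1 / 2) * (D j i m j i + D j i j m i - D j i i m j)
      - (1 / 2) * (D j m i j i + D j m j i i - D j m i i j))
    = (1 / 2) * ∑ j, ∑ i, ((1 / 2) * (D m i j j i + D m i j j i - D m i i j j)
      - (1 / 2) * (D m j i j i + D m j j i i - D m j i i j))
  replace c1 : ∀ a b c i j, D a b c i j = D b a c i j := c1
  replace c2 : ∀ a b c i j, D a b c i j = D a c b i j := c2
  replace s : ∀ a b c i j, D a b c i j = D a b c j i := s
  clear_value D
  have sw : ∑ j, ∑ i, D j i i m j = ∑ j, ∑ i, D j i j m i := by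
    rw [Finset.sum_comm]
    exact Finset.sum_congr rfl fun i _ => Finset.sum_congr rfl fun j _ => by rw [c1]
  have sw2 : ∑ j, ∑ i, D m i i j j = ∑ j, ∑ i, D m j j i i := Finset.sum_comm
  have e1 : ∀ i j, D j i m j i = D m i j j i := fun i j => by rw [c2, c1, c2]
  have e2 : ∀ i j, D j m i j i = D m i j j i := fun i j => by rw [c1, c2]
  have e3 : ∀ i j, D j m j i i = D m j j i i := fun i j => by rw [c1]
  have e4 : ∀ i j, D j m i i j = D m i j j i := fun i j => by rw [c1, c2, s]
  have e5 : ∑ j, ∑ i, D m j i j i = ∑ j, ∑ i, D m j i i j :=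
    Finset.sum_congr rfl fun i _ => Finset.sum_congr rfl fun j _ => by rw [s]
  have e6 : ∀ i j, D m j i i j = D m i j j i := fun i j => by rw [c2, s]
  simp only [e1, e2, e3, e4, e6]
  simp only [Finset.sum_sub_distrib, Finset.sum_add_distrib, ← Finset.mul_sum, sw, sw2, e5]
  ring

/-- A curvature symmetry, read off from second derivatives of the metric. It identifies the
contraction produced by commuting covariant derivatives as the Ricci tensor. -/
theorem sum_riemann_eq_ricci (m l : Fin n) :
    ∑ j, riemann G m j j l y = ricci G m l y := by
  simp_rw [ricci, h.riemann_eq, h.partialDeriv_christoffel]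
  refine Finset.sum_congr rfl fun i _ => ?_
  rw [h.partialDeriv_symm i m l i, h.partialDeriv_symm i i m l,
    partialDeriv_comm (h.smooth i l) i m, h.partialDeriv_symm i l m i, h.partialDeriv_symm i i l m,
    h.partialDeriv_symm m i l i]
  ring

theorem hessian_eq (F : EuclideanSpace ℝ (Fin n) → ℝ) (i j : Fin n) :
    hessian G F i j y = partialDeriv i (partialDeriv j F) y := by
  simp [hessian, h.christoffel_eq_zero]

variable {F : EuclideanSpace ℝ (Fin n) → ℝ} (hF : SmoothNear F y)
include hF

theorem partialDeriv_hessian (m j k : Fin n) : partialDeriv m (hessian G F j k) y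
    = partialDeriv m (partialDeriv j (partialDeriv k F)) y
      - ∑ l, partialDeriv m (christoffel G j k l) y * partialDeriv l F y := by
  have hc := fun a b c => smoothNear_christoffel h.smooth h.det_ne_zero a b c
  have hm := fun l => (hc j k l).mul (hF.partialDeriv l)
  have e : hessian G F j k = fun y => partialDeriv j (partialDeriv k F) y
    - ∑ l, christoffel G j k l y * partialDeriv l F y := rfl
  rw [e, partialDeriv_sub ((hF.partialDeriv k).partialDeriv j).differentiableAt
    (SmoothNear.sum fun l _ => hm l).differentiableAt,
    partialDeriv_sum fun l _ => (hm l).differentiableAt]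
  simp_rw [fun l => partialDeriv_mul (hc j k l).differentiableAt
    (hF.partialDeriv l).differentiableAt m, h.christoffel_eq_zero]
  simp

/-- On a steady soliton, `∇R = -2 Ric(∇f)`. -/
theorem partialDeriv_scalar_of_soliton
    (hs : ∀ᶠ z in nhds y, ∀ i j, ricci G i j z = hessian G F i j z) (m : Fin n) :
    partialDeriv m (scalar G) y = - 2 * ∑ l, ricci G m l y * partialDeriv l F y := by
  have e : ∀ a j k, partialDeriv a (ricci G j k) y
      = partialDeriv a (partialDeriv j (partialDeriv k F)) y
      - ∑ l, partialDeriv a (christoffel G j k l) y * partialDeriv l F y := fun a j k => by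
    rw [← h.partialDeriv_hessian hF]
    exact partialDeriv_congr (hs.mono fun _ hz => hz j k) a
  have h1 := h.sum_partialDeriv_ricci m
  have h2 := h.partialDeriv_scalar m
  -- The commutation formula `div Hess F - ∇ ΔF = Ric (∇F)`. By Bianchi (`h1`) and the soliton
  -- equation its left side is `½ ∇R - ∇R`.
  have h3 : ∑ j, partialDeriv j (ricci G m j) y - ∑ j, partialDeriv m (ricci G j j) y
      = ∑ l, ricci G m l y * partialDeriv l F y := by
    simp_rw [← h.sum_riemann_eq_ricci, h.riemann_eq, Finset.sum_mul]
    rw [Finset.sum_comm, ← Finset.sum_sub_distrib]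
    refine Finset.sum_congr rfl fun j _ => ?_
    rw [e, e, partialDeriv_comm (hF.partialDeriv j) j m]
    simp_rw [sub_mul, Finset.sum_sub_distrib]
    ring
  linarith

/-- The differential of `|∇F|²` at the centre. -/
theorem partialDeriv_gradSq (m : Fin n) :
    partialDeriv m (fun z => ∑ i, ∑ j, (G z)⁻¹ i j * (partialDeriv i F z * partialDeriv j F z)) y
      = 2 * ∑ l, hessian G F m l y * partialDeriv l F y := by
  have hp := fun i => hF.partialDeriv i
  have hm := fun i j => (h.smooth_inv i j).mul ((hp i).mul (hp j))
  rw [partialDeriv_sum fun i _ => (SmoothNear.sum fun j _ => hm i j).differentiableAt,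
    Finset.mul_sum]
  refine Finset.sum_congr rfl fun i _ => ?_
  rw [partialDeriv_sum fun j _ => (hm i j).differentiableAt]
  simp_rw [fun j => partialDeriv_mul (h.smooth_inv i j).differentiableAt
    ((hp i).mul (hp j)).differentiableAt m, fun j => partialDeriv_mul (hp i).differentiableAt
    (hp j).differentiableAt m, h.partialDeriv_inv, h.inv_eq_one, Matrix.one_apply,
    h.hessian_eq F]
  simp
  ring

end IsNormalAt

end NormalCoordinates

/-! ### Bilinear forms, the Koszul formula and the Christoffel symbols. -/

section Tensor

variable {n : ℕ}

/-- The bilinear form with the given matrix. -/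
def matrixForm (A : Matrix (Fin n) (Fin n) ℝ) :
    EuclideanSpace ℝ (Fin n) →L[ℝ] EuclideanSpace ℝ (Fin n) →L[ℝ] ℝ :=
  ∑ i, ∑ j, A i j • (EuclideanSpace.proj i : EuclideanSpace ℝ (Fin n) →L[ℝ] ℝ).smulRight
    (EuclideanSpace.proj j : EuclideanSpace ℝ (Fin n) →L[ℝ] ℝ)

theorem matrixForm_apply (A : Matrix (Fin n) (Fin n) ℝ) (u v : EuclideanSpace ℝ (Fin n)) :
    matrixForm A u v = ∑ i, ∑ j, A i j * u i * v j := by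
  simp [matrixForm, mul_assoc]

@[simp]
theorem matrixForm_single (A : Matrix (Fin n) (Fin n) ℝ) (i j : Fin n) :
    matrixForm A (EuclideanSpace.single i 1) (EuclideanSpace.single j 1) = A i j := by
  simp [matrixForm_apply]

theorem matrixForm_symm {A : Matrix (Fin n) (Fin n) ℝ} (hA : ∀ i j, A i j = A j i)
    (u v : EuclideanSpace ℝ (Fin n)) : matrixForm A u v = matrixForm A v u := by
  rw [matrixForm_apply, matrixForm_apply, Finset.sum_comm]
  refine Finset.sum_congr rfl fun i _ => Finset.sum_congr rfl fun j _ => ?_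
  rw [hA j i]
  ring

theorem eq_zero_of_matrixForm {A : Matrix (Fin n) (Fin n) ℝ} (hA : A.det ≠ 0)
    {u : EuclideanSpace ℝ (Fin n)} (h : ∀ v, matrixForm A u v = 0) : u = 0 := by
  have h1 : Matrix.vecMul u.ofLp A = 0 := by
    ext j
    have := h (EuclideanSpace.single j 1)
    simp [matrixForm_apply] at this
    simp [Matrix.vecMul, dotProduct, ← this, mul_comm]
  have := Matrix.eq_zero_of_vecMul_eq_zero hA h1
  ext j
  simp [this]

variable {G : EuclideanSpace ℝ (Fin n) → Matrix (Fin n) (Fin n) ℝ}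
  {y : EuclideanSpace ℝ (Fin n)}

variable (G y) in
/-- The derivative of the metric coefficients in the direction `w`, as a bilinear form. -/
def metricDeriv (w u v : EuclideanSpace ℝ (Fin n)) : ℝ :=
  ∑ i, ∑ j, fderiv ℝ (fun z => G z i j) y w * u i * v j

theorem metricDeriv_eq_sum (w u v : EuclideanSpace ℝ (Fin n)) :
    metricDeriv G y w u v
      = ∑ i, ∑ j, ∑ l, partialDeriv l (fun z => G z i j) y * w l * u i * v j := by
  simp only [metricDeriv, fderiv_eq_sum_partialDeriv, Finset.sum_mul]
  exact Finset.sum_congr rfl fun i _ => Finset.sum_congr rfl fun j _ =>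
    Finset.sum_congr rfl fun l _ => by ring

/-- The product rule with a moving base point `T z`, so that both sides of a pullback identity can
be differentiated with it (`T = id` on one side). -/
theorem fderiv_matrixForm_comp {T a b : EuclideanSpace ℝ (Fin n) → EuclideanSpace ℝ (Fin n)}
    (hG : ∀ i j, DifferentiableAt ℝ (fun z => G z i j) (T y)) (hT : DifferentiableAt ℝ T y)
    (ha : DifferentiableAt ℝ a y) (hb : DifferentiableAt ℝ b y) (w : EuclideanSpace ℝ (Fin n)) :
    fderiv ℝ (fun z => matrixForm (G (T z)) (a z) (b z)) y w
      = metricDeriv G (T y) (fderiv ℝ T y w) (a y) (b y)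
        + matrixForm (G (T y)) (fderiv ℝ a y w) (b y)
        + matrixForm (G (T y)) (a y) (fderiv ℝ b y w) := by
  have hc : ∀ (a : EuclideanSpace ℝ (Fin n) → EuclideanSpace ℝ (Fin n)), DifferentiableAt ℝ a y →
      ∀ i, HasFDerivAt (fun z => a z i)
        ((EuclideanSpace.proj i : EuclideanSpace ℝ (Fin n) →L[ℝ] ℝ).comp (fderiv ℝ a y)) y :=
    fun a ha i => (EuclideanSpace.proj i : EuclideanSpace ℝ (Fin n) →L[ℝ] ℝ).hasFDerivAt.comp y
      ha.hasFDerivAt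
  have h := HasFDerivAt.fun_sum fun i (_ : i ∈ Finset.univ) =>
    HasFDerivAt.fun_sum fun j (_ : j ∈ Finset.univ) =>
    (((hG i j).hasFDerivAt.comp y hT.hasFDerivAt).mul (hc a ha i)).mul (hc b hb j)
  have e : (fun z => matrixForm (G (T z)) (a z) (b z))
      = fun z => ∑ i, ∑ j, ((fun z => G z i j) ∘ T) z * a z i * b z j := by
    ext z
    exact matrixForm_apply _ _ _
  rw [e]
  refine (congrArg (fun L => L w) h.fderiv).trans ?_
  simp only [metricDeriv, matrixForm_apply, ← Finset.sum_add_distrib]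
  simp only [sum_apply, add_apply, smul_apply, ContinuousLinearMap.comp_apply,
    PiLp.proj_apply, smul_eq_mul, Function.comp_apply]
  exact Finset.sum_congr rfl fun i _ => Finset.sum_congr rfl fun j _ => by
    simp only [Pi.mul_apply, Function.comp_apply]
    ring

variable (G y) in
/-- The Koszul form `⟨∇_u v, w⟩` for constant vectors. -/
def koszul (u v w : EuclideanSpace ℝ (Fin n)) : ℝ :=
  (1 / 2) * (metricDeriv G y u v w
    + metricDeriv G y v u w
    - metricDeriv G y w u v)

variable (G y) in
/-- The Christoffel symbols as a bilinear map. -/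
def christoffelMap :
    EuclideanSpace ℝ (Fin n) →L[ℝ] EuclideanSpace ℝ (Fin n) →L[ℝ] EuclideanSpace ℝ (Fin n) :=
  ∑ i, ∑ j, ∑ k, christoffel G i j k y •
    (EuclideanSpace.proj i : EuclideanSpace ℝ (Fin n) →L[ℝ] ℝ).smulRight
      ((EuclideanSpace.proj j : EuclideanSpace ℝ (Fin n) →L[ℝ] ℝ).smulRight
        (EuclideanSpace.single k (1 : ℝ)))

theorem christoffelMap_apply (u v : EuclideanSpace ℝ (Fin n)) (k : Fin n) :
    christoffelMap G y u v k = ∑ i, ∑ j, christoffel G i j k y * u i * v j := by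
  simp [christoffelMap, Finset.sum_apply, Pi.single_apply,
    mul_assoc]

/-- `G` consists of the coefficients of a smooth Riemannian metric near `y`. -/
structure IsMetricNear (G : EuclideanSpace ℝ (Fin n) → Matrix (Fin n) (Fin n) ℝ)
    (y : EuclideanSpace ℝ (Fin n)) : Prop where
  smooth : ∀ i j, SmoothNear (fun z => G z i j) y
  symm : ∀ᶠ z in nhds y, ∀ i j, G z i j = G z j i
  posDef : (G y).PosDef

namespace IsMetricNear

variable (h : IsMetricNear G y)
include h

theorem det_ne_zero : (G y).det ≠ 0 := h.posDef.det_pos.ne'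

theorem metricDeriv_symm (w u v : EuclideanSpace ℝ (Fin n)) :
    metricDeriv G y w u v
      = metricDeriv G y w v u := by
  rw [metricDeriv_eq_sum, metricDeriv_eq_sum, Finset.sum_comm]
  refine Finset.sum_congr rfl fun i _ => Finset.sum_congr rfl fun j _ =>
    Finset.sum_congr rfl fun l _ => ?_
  rw [partialDeriv_congr (h.symm.mono fun z hz => hz j i)]
  ring

theorem koszul_comm (u v w : EuclideanSpace ℝ (Fin n)) : koszul G y u v w = koszul G y v u w := by
  rw [koszul, koszul, h.metricDeriv_symm w u v]
  ring

/-- Lowering the index with `G` cancels the `G⁻¹` in the Christoffel symbols, which leaves the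
Koszul formula. -/
theorem matrixForm_christoffelMap (u v w : EuclideanSpace ℝ (Fin n)) :
    matrixForm (G y) (christoffelMap G y u v) w = koszul G y u v w := by
  have key : ∀ i j m, ∑ k, G y k m * christoffel G i j k y
      = (1 / 2) * (partialDeriv i (fun z => G z j m) y + partialDeriv j (fun z => G z i m) y
        - partialDeriv m (fun z => G z i j) y) := by
    intro i j m
    set K : Fin n → ℝ := fun l => partialDeriv i (fun z => G z j l) y
      + partialDeriv j (fun z => G z i l) y - partialDeriv l (fun z => G z i j) y
    have e : ∀ k, christoffel G i j k y = (1 / 2) * Matrix.mulVec (G y)⁻¹ K k := fun k => rfl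
    have hm := congrFun (Matrix.mulVec_mulVec K (G y) (G y)⁻¹) m
    rw [Matrix.mul_nonsing_inv _ (isUnit_iff_ne_zero.2 h.det_ne_zero), Matrix.one_mulVec] at hm
    change _ = (1 / 2) * K m
    rw [← hm]
    conv_rhs => rw [Matrix.mulVec, dotProduct, Finset.mul_sum]
    refine Finset.sum_congr rfl fun k _ => ?_
    rw [e, h.symm.self_of_nhds k m]
    ring
  have e1 : matrixForm (G y) (christoffelMap G y u v) w
      = ∑ i, ∑ j, ∑ m, (∑ k, G y k m * christoffel G i j k y) * u i * v j * w m := by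
    simp_rw [matrixForm_apply, christoffelMap_apply, Finset.mul_sum, Finset.sum_mul]
    rw [Finset.sum_comm]
    have : ∀ m : Fin n, ∑ k, ∑ i, ∑ j, G y k m * (christoffel G i j k y * u i * v j) * w m
        = ∑ i, ∑ j, ∑ k, G y k m * christoffel G i j k y * u i * v j * w m := by
      intro m
      rw [Finset.sum_comm]
      refine Finset.sum_congr rfl fun i _ => ?_
      rw [Finset.sum_comm]
      exact Finset.sum_congr rfl fun j _ => Finset.sum_congr rfl fun k _ => by ring
    simp_rw [this]
    rw [Finset.sum_comm]
    exact Finset.sum_congr rfl fun i _ => Finset.sum_comm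
  rw [e1, koszul]
  simp_rw [key, metricDeriv_eq_sum]
  have p1 : ∑ i, ∑ j, ∑ l, partialDeriv l (fun z => G z i j) y * u l * v i * w j
      = ∑ i, ∑ j, ∑ m, partialDeriv i (fun z => G z j m) y * u i * v j * w m := by
    rw [Finset.sum_congr rfl fun i _ => Finset.sum_comm, Finset.sum_comm]
  have p2 : ∑ i, ∑ j, ∑ l, partialDeriv l (fun z => G z i j) y * v l * u i * w j
      = ∑ i, ∑ j, ∑ m, partialDeriv j (fun z => G z i m) y * u i * v j * w m := by
    refine Finset.sum_congr rfl fun i _ => ?_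
    rw [Finset.sum_comm]
    exact Finset.sum_congr rfl fun j _ => Finset.sum_congr rfl fun l _ => by ring
  have p3 : ∑ i, ∑ j, ∑ l, partialDeriv l (fun z => G z i j) y * w l * u i * v j
      = ∑ i, ∑ j, ∑ m, partialDeriv m (fun z => G z i j) y * u i * v j * w m :=
    Finset.sum_congr rfl fun i _ => Finset.sum_congr rfl fun j _ =>
      Finset.sum_congr rfl fun l _ => by ring
  rw [p1, p2, p3]
  simp only [← Finset.sum_add_distrib, ← Finset.sum_sub_distrib, Finset.mul_sum]
  exact Finset.sum_congr rfl fun i _ => Finset.sum_congr rfl fun j _ =>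
      Finset.sum_congr rfl fun l _ => by ring

theorem christoffelMap_comm (u v : EuclideanSpace ℝ (Fin n)) :
    christoffelMap G y u v = christoffelMap G y v u := by
  refine sub_eq_zero.1 (eq_zero_of_matrixForm h.det_ne_zero fun w => ?_)
  rw [map_sub, sub_apply, h.matrixForm_christoffelMap,
    h.matrixForm_christoffelMap, h.koszul_comm, sub_self]

end IsMetricNear

end Tensor

/-! ### Christoffel symbols, Hessian and Laplacian under a change of coordinates. -/

section Hessian

variable {n : ℕ} {G : EuclideanSpace ℝ (Fin n) → Matrix (Fin n) (Fin n) ℝ}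
  {y : EuclideanSpace ℝ (Fin n)} {F : EuclideanSpace ℝ (Fin n) → ℝ}

/-- The Hessian of `F` as a bilinear form. -/
theorem hessian_eq_fderiv (hF : SmoothNear F y) (i j : Fin n) :
    hessian G F i j y
      = fderiv ℝ (fderiv ℝ F) y (EuclideanSpace.single i 1) (EuclideanSpace.single j 1)
        - fderiv ℝ F y (christoffelMap G y (EuclideanSpace.single i 1)
          (EuclideanSpace.single j 1)) := by
  have hd : DifferentiableAt ℝ (fderiv ℝ F) y :=
    (hF.self.fderiv_right (m := ∞) (by simp)).differentiableAt (by simp)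
  have e : partialDeriv j F = fun z => fderiv ℝ F z (EuclideanSpace.single j 1) := rfl
  have e2 : partialDeriv i (partialDeriv j F) y
      = fderiv ℝ (fderiv ℝ F) y (EuclideanSpace.single i 1) (EuclideanSpace.single j 1) := by
    rw [e, partialDeriv, fderiv_clm_apply hd (differentiableAt_const _)]
    simp
  rw [hessian, e2, fderiv_eq_sum_partialDeriv (christoffelMap G y _ _)]
  simp [christoffelMap_apply]

end Hessian

section Pullback

variable {n : ℕ}

/-- `G'` is at `z` the pullback of the metric coefficients `G` under `T`. -/
def IsPullbackAt (G' G : EuclideanSpace ℝ (Fin n) → Matrix (Fin n) (Fin n) ℝ)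
    (T : EuclideanSpace ℝ (Fin n) → EuclideanSpace ℝ (Fin n))
    (z : EuclideanSpace ℝ (Fin n)) : Prop :=
  ∀ u v, matrixForm (G' z) u v = matrixForm (G (T z)) (fderiv ℝ T z u) (fderiv ℝ T z v)

variable {G G' : EuclideanSpace ℝ (Fin n) → Matrix (Fin n) (Fin n) ℝ}
  {T : EuclideanSpace ℝ (Fin n) → EuclideanSpace ℝ (Fin n)} {y : EuclideanSpace ℝ (Fin n)}
  (hT : ContDiffAt ℝ ∞ T y) (hp : ∀ᶠ z in nhds y, IsPullbackAt G' G T z)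
  (hG : IsMetricNear G (T y))

include hT hp hG

theorem metricDeriv_pullback (hG' : ∀ i j, DifferentiableAt ℝ (fun z => G' z i j) y)
    (w u v : EuclideanSpace ℝ (Fin n)) :
    metricDeriv G' y w u v
      = metricDeriv G (T y) (fderiv ℝ T y w) (fderiv ℝ T y u) (fderiv ℝ T y v)
        + matrixForm (G (T y)) (fderiv ℝ (fderiv ℝ T) y w u) (fderiv ℝ T y v)
        + matrixForm (G (T y)) (fderiv ℝ T y u) (fderiv ℝ (fderiv ℝ T) y w v) := by
  have hTd : DifferentiableAt ℝ T y := hT.differentiableAt (by simp)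
  have hTd2 : DifferentiableAt ℝ (fderiv ℝ T) y :=
    (hT.fderiv_right (m := ∞) (by simp)).differentiableAt (by simp)
  have hTu : ∀ u, DifferentiableAt ℝ (fun z => fderiv ℝ T z u) y := fun u =>
    hTd2.clm_apply (differentiableAt_const u)
  have h1 := fderiv_matrixForm_comp (T := id) hG' differentiableAt_id
    (differentiableAt_const u) (differentiableAt_const v) w
  have h2 := fderiv_matrixForm_comp (fun i j => (hG.smooth i j).differentiableAt) hTd
    (hTu u) (hTu v) w
  have h3 : (fun z => matrixForm (G' (id z)) u v) =ᶠ[nhds y]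
      fun z => matrixForm (G (T z)) (fderiv ℝ T z u) (fderiv ℝ T z v) := hp.mono fun z hz => hz u v
  rw [h3.fderiv_eq, h2] at h1
  have e : ∀ u, fderiv ℝ (fun z => fderiv ℝ T z u) y w = fderiv ℝ (fderiv ℝ T) y w u := by
    intro u
    rw [fderiv_clm_apply hTd2 (differentiableAt_const u)]
    simp
  simpa [e] using h1.symm

/-- The inhomogeneous transformation law. By nondegeneracy it may be tested against vectors in the
image of the differential, where the Koszul formula applies on both sides; symmetry of the second
derivative of `T` makes all but one kind of second-order term cancel. -/
theorem fderiv_christoffelMap_pullback (hG' : IsMetricNear G' y)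
    (hsurj : Function.Surjective (fderiv ℝ T y)) (u v : EuclideanSpace ℝ (Fin n)) :
    fderiv ℝ T y (christoffelMap G' y u v)
      = christoffelMap G (T y) (fderiv ℝ T y u) (fderiv ℝ T y v)
        + fderiv ℝ (fderiv ℝ T) y u v := by
  have hs : IsSymmSndFDerivAt ℝ T y := hT.isSymmSndFDerivAt (by
    rw [minSmoothness_of_isRCLikeNormedField]
    exact WithTop.coe_le_coe.2 le_top)
  refine sub_eq_zero.1 (eq_zero_of_matrixForm hG.det_ne_zero fun w' => ?_)
  obtain ⟨w, rfl⟩ := hsurj w'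
  have hd := fun i j => (hG'.smooth i j).differentiableAt
  rw [map_sub, sub_apply, map_add, add_apply,
    hG.matrixForm_christoffelMap, ← hp.self_of_nhds, hG'.matrixForm_christoffelMap]
  simp only [koszul, metricDeriv_pullback hT hp hG hd]
  rw [hs v u, hs w u, hs w v,
    matrixForm_symm hG.symm.self_of_nhds (fderiv ℝ T y v) (fderiv ℝ (fderiv ℝ T) y u w)]
  ring

variable {F : EuclideanSpace ℝ (Fin n) → ℝ}

/-- The term `dF (D²T)` from the chain rule cancels the inhomogeneous term of the Christoffel
symbols. -/
theorem hessian_pullback (hG' : IsMetricNear G' y)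
    (hsurj : Function.Surjective (fderiv ℝ T y)) {F' : EuclideanSpace ℝ (Fin n) → ℝ}
    (hF : SmoothNear F (T y)) (hF' : SmoothNear F' y) (he : F' =ᶠ[nhds y] F ∘ T) (i j : Fin n) :
    hessian G' F' i j y = ∑ a, ∑ b, hessian G F a b (T y)
      * fderiv ℝ T y (EuclideanSpace.single i 1) a
      * fderiv ℝ T y (EuclideanSpace.single j 1) b := by
  have hTd : HasFDerivAt T (fderiv ℝ T y) y := (hT.differentiableAt (by simp)).hasFDerivAt
  have hTd2 : HasFDerivAt (fderiv ℝ T) (fderiv ℝ (fderiv ℝ T) y) y :=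
    ((hT.fderiv_right (m := ∞) (by simp)).differentiableAt (by simp)).hasFDerivAt
  have hFd2 : HasFDerivAt (fderiv ℝ F) (fderiv ℝ (fderiv ℝ F) (T y)) (T y) :=
    ((hF.self.fderiv_right (m := ∞) (by simp)).differentiableAt (by simp)).hasFDerivAt
  have h1 : fderiv ℝ F' =ᶠ[nhds y] fun z => (fderiv ℝ F (T z)).comp (fderiv ℝ T z) := by
    have a := hT.continuousAt.eventually hF.eventually_differentiableAt
    have b : ∀ᶠ z in nhds y, DifferentiableAt ℝ T z :=
      ((hT.of_le (m := 1) (by simp)).eventually (by simp)).mono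
        fun z hz => hz.differentiableAt (by simp)
    filter_upwards [he.eventuallyEq_nhds, a, b] with z hz ha hb
    rw [hz.fderiv_eq, fderiv_comp _ ha hb]
  have h2 : ∀ u v, fderiv ℝ (fderiv ℝ F') y u v
      = fderiv ℝ (fderiv ℝ F) (T y) (fderiv ℝ T y u) (fderiv ℝ T y v)
        + fderiv ℝ F (T y) (fderiv ℝ (fderiv ℝ T) y u v) := by
    intro u v
    have := ((hFd2.comp y hTd).clm_comp hTd2)
    rw [h1.fderiv_eq]
    refine (congrArg (fun L => L u v) this.fderiv).trans ?_
    simp [add_comm]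
  have h3 : ∀ u v, ∑ a, ∑ b, hessian G F a b (T y) * u a * v b
      = fderiv ℝ (fderiv ℝ F) (T y) u v - fderiv ℝ F (T y) (christoffelMap G (T y) u v) := by
    intro u v
    have hu : ∀ u : EuclideanSpace ℝ (Fin n), u = ∑ i, u i • EuclideanSpace.single i (1 : ℝ) := by
      intro u
      ext j
      simp [Finset.sum_apply, Pi.single_apply]
    conv_rhs => rw [hu u, hu v]
    simp only [map_sum, map_smul, sum_apply, smul_apply,
      ← Finset.sum_sub_distrib, smul_eq_mul, Finset.mul_sum, hessian_eq_fderiv hF]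
    rw [Finset.sum_comm]
    exact Finset.sum_congr rfl fun a _ => Finset.sum_congr rfl fun b _ => by ring
  rw [h3, hessian_eq_fderiv hF', h2, h1.self_of_nhds, ContinuousLinearMap.comp_apply,
    fderiv_christoffelMap_pullback hT hp hG hG' hsurj, map_add]
  ring

/-- With `J` the Jacobian matrix, `G' = JᵀGJ` and `H' = JᵀHJ`, so the two traces agree by cyclicity.
-/
theorem laplacian_pullback (hG' : IsMetricNear G' y)
    (hsurj : Function.Surjective (fderiv ℝ T y)) {F' : EuclideanSpace ℝ (Fin n) → ℝ}
    (hF : SmoothNear F (T y)) (hF' : SmoothNear F' y) (he : F' =ᶠ[nhds y] F ∘ T) :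
    ∑ i, ∑ j, (G' y)⁻¹ i j * hessian G' F' i j y
      = ∑ i, ∑ j, (G (T y))⁻¹ i j * hessian G F i j (T y) := by
  set J : Matrix (Fin n) (Fin n) ℝ := Matrix.of fun a i =>
    fderiv ℝ T y (EuclideanSpace.single i 1) a
  set H : Matrix (Fin n) (Fin n) ℝ := Matrix.of fun a b => hessian G F a b (T y)
  set H' : Matrix (Fin n) (Fin n) ℝ := Matrix.of fun a b => hessian G' F' a b y
  have tr : ∀ A B : Matrix (Fin n) (Fin n) ℝ, ∑ i, ∑ j, A i j * B i j
      = (A * B.transpose).trace := fun A B => by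
    simp [Matrix.trace, Matrix.mul_apply]
  have mul3 : ∀ (A : Matrix (Fin n) (Fin n) ℝ) i j, (J.transpose * A * J) i j
      = ∑ a, ∑ b, A a b * J a i * J b j := by
    intro A i j
    simp only [Matrix.mul_apply, Matrix.transpose_apply, Finset.sum_mul]
    rw [Finset.sum_comm]
    exact Finset.sum_congr rfl fun a _ => Finset.sum_congr rfl fun b _ => by ring
  have hH : H' = J.transpose * H * J := by
    ext i j
    rw [mul3]
    exact hessian_pullback hT hp hG hG' hsurj hF hF' he i j
  have hGG : G' y = J.transpose * G (T y) * J := by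
    ext i j
    rw [mul3, ← matrixForm_single (G' y), hp.self_of_nhds, matrixForm_apply]
    rfl
  have hdet : (G' y).det = J.det * (G (T y)).det * J.det := by
    rw [hGG, Matrix.det_mul, Matrix.det_mul, Matrix.det_transpose]
  have hJ : IsUnit J.det := isUnit_iff_ne_zero.2 fun h0 => hG'.det_ne_zero (by simp [hdet, h0])
  change ∑ i, ∑ j, (G' y)⁻¹ i j * H' i j = ∑ i, ∑ j, (G (T y))⁻¹ i j * H i j
  rw [tr, tr, hH, hGG, Matrix.mul_inv_rev, Matrix.mul_inv_rev, Matrix.transpose_mul,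
    Matrix.transpose_mul, Matrix.transpose_transpose, Matrix.trace_mul_comm]
  have e1 : J.transpose * (H.transpose * J) * (J⁻¹ * ((G (T y))⁻¹ * J.transpose⁻¹))
      = J.transpose * (H.transpose * (G (T y))⁻¹) * J.transpose⁻¹ := by
    simp only [Matrix.mul_assoc]
    rw [Matrix.mul_nonsing_inv_cancel_left _ _ hJ]
  have hJt : IsUnit J.transpose.det := by rwa [Matrix.det_transpose]
  rw [e1, Matrix.trace_mul_comm, Matrix.nonsing_inv_mul_cancel_left _ _ hJt,
    Matrix.trace_mul_comm]

end Pullback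

/-! ### Coordinates in which the metric is Euclidean to first order. -/

section NormalMap

open scoped MatrixOrder in
open Matrix in
/-- A positive definite bilinear form is the standard one in suitable linear coordinates. -/
theorem exists_matrixForm_eq_one {n : ℕ} {A : Matrix (Fin n) (Fin n) ℝ} (hA : A.PosDef) :
    ∃ L : EuclideanSpace ℝ (Fin n) ≃L[ℝ] EuclideanSpace ℝ (Fin n),
      ∀ u v, matrixForm A (L u) (L v) = matrixForm 1 u v := by
  -- Factor `A = BᵀB`; the change of coordinates is `B⁻¹`.
  obtain ⟨B, hB⟩ := CStarAlgebra.nonneg_iff_eq_star_mul_self.mp hA.posSemidef.nonneg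
  have hdet : B.det ≠ 0 := fun h0 => hA.det_pos.ne' (by rw [hB, det_mul, h0, mul_zero])
  have hu : IsUnit B.det := isUnit_iff_ne_zero.2 hdet
  have key : ∀ (C : Matrix (Fin n) (Fin n) ℝ) (u v : EuclideanSpace ℝ (Fin n)),
      matrixForm C u v = u.ofLp ⬝ᵥ C *ᵥ v.ofLp := by
    intro C u v
    simp only [matrixForm_apply, dotProduct, mulVec, Finset.mul_sum]
    exact Finset.sum_congr rfl fun i _ => Finset.sum_congr rfl fun j _ => by ring
  refine ⟨(LinearEquiv.ofLinearMap (toEuclideanLin B⁻¹) (toEuclideanLin B) ?_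
    ?_).toContinuousLinearEquiv, fun u v => ?_⟩
  · ext1 x
    simp [toLpLin_apply, mulVec_mulVec, nonsing_inv_mul _ hu]
  · ext1 x
    simp [toLpLin_apply, mulVec_mulVec, mul_nonsing_inv _ hu]
  · rw [key, key]
    change (B⁻¹ *ᵥ u.ofLp) ⬝ᵥ A *ᵥ (B⁻¹ *ᵥ v.ofLp) = _
    have hs : star B = Bᵀ := by
      ext i j
      simp [star_apply]
    rw [hB, hs, mulVec_mulVec, Matrix.mul_assoc, mul_nonsing_inv _ hu, Matrix.mul_one,
      dotProduct_mulVec, vecMul_transpose, mulVec_mulVec, mul_nonsing_inv _ hu, one_mulVec,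
      one_mulVec]

variable {n : ℕ} {G : EuclideanSpace ℝ (Fin n) → Matrix (Fin n) (Fin n) ℝ}
  {x : EuclideanSpace ℝ (Fin n)}

/-- Around any point there are coordinates in which the metric is Euclidean to first order. -/
theorem IsMetricNear.exists_normal (h : IsMetricNear G x) :
    ∃ (T : EuclideanSpace ℝ (Fin n) → EuclideanSpace ℝ (Fin n))
      (L : EuclideanSpace ℝ (Fin n) ≃L[ℝ] EuclideanSpace ℝ (Fin n)),
      ContDiff ℝ ∞ T ∧ T 0 = x ∧
      HasFDerivAt T (L : EuclideanSpace ℝ (Fin n) →L[ℝ] EuclideanSpace ℝ (Fin n)) 0 ∧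
      ∀ G' : EuclideanSpace ℝ (Fin n) → Matrix (Fin n) (Fin n) ℝ,
        IsMetricNear G' 0 → (∀ᶠ z in nhds 0, IsPullbackAt G' G T z) → IsNormalAt G' 0 := by
  obtain ⟨L, hL⟩ := exists_matrixForm_eq_one h.posDef
  set C := christoffelMap G x with hC
  -- The linear part `L` normalizes the metric at the point; the quadratic correction removes its
  -- first derivatives, as the second derivative of `T` is then `-C (L u) (L v)`.
  set T : EuclideanSpace ℝ (Fin n) → EuclideanSpace ℝ (Fin n) := fun z =>
    x + L z - (1 / 2 : ℝ) • C (L z) (L z) with hT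
  have hTc : ContDiff ℝ ∞ T := by
    refine (contDiff_const.add L.contDiff).sub (ContDiff.const_smul _ ?_)
    exact (C.contDiff.comp L.contDiff).clm_apply L.contDiff
  have hd : ∀ z w, fderiv ℝ T z w = L w - C (L z) (L w) := by
    intro z w
    have hLd : HasFDerivAt L (L : EuclideanSpace ℝ (Fin n) →L[ℝ] EuclideanSpace ℝ (Fin n)) z :=
      L.hasFDerivAt
    have h1 := (hLd.const_add x).sub
      (((C.hasFDerivAt.comp z hLd).clm_apply hLd).const_smul (1 / 2 : ℝ))
    refine (congrArg (fun L => L w) h1.fderiv).trans ?_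
    have : C (L w) (L z) = C (L z) (L w) := h.christoffelMap_comm _ _
    simp [this]
    rw [← add_smul]
    norm_num
  have hT0 : T 0 = x := by simp [hT]
  have hd2 : ∀ u v, fderiv ℝ (fderiv ℝ T) 0 u v = - C (L u) (L v) := by
    intro u v
    have hf : DifferentiableAt ℝ (fderiv ℝ T) 0 :=
      (hTc.contDiffAt.fderiv_right (m := ∞) (by simp)).differentiableAt (by simp)
    have e : fderiv ℝ (fun z => fderiv ℝ T z v) 0 u = fderiv ℝ (fderiv ℝ T) 0 u v := by
      rw [fderiv_clm_apply hf (differentiableAt_const v)]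
      simp
    rw [← e]
    have h1 : (fun z => fderiv ℝ T z v) = fun z => L v - C (L z) (L v) := funext fun z => hd z v
    have hLd : HasFDerivAt L (L : EuclideanSpace ℝ (Fin n) →L[ℝ] EuclideanSpace ℝ (Fin n)) 0 :=
      L.hasFDerivAt
    have h2 := ((C.hasFDerivAt.comp 0 hLd).clm_apply (hasFDerivAt_const (L v) 0)).const_sub (L v)
    rw [h1]
    refine (congrArg (fun L => L u) h2.fderiv).trans ?_
    simp
  have hd0 : fderiv ℝ T 0 = L := by
    ext1 w
    simp [hd]
  refine ⟨T, L, hTc, hT0, hd0 ▸ (hTc.differentiable (by simp) 0).hasFDerivAt, ?_⟩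
  intro G' hG' hp
  have h' : IsMetricNear G (T 0) := hT0 ▸ h
  refine ⟨hG'.smooth, hG'.symm, ?_, fun l i j => ?_⟩
  · ext i j
    rw [← matrixForm_single (G' 0), hp.self_of_nhds, hd0, hT0]
    refine (hL _ _).trans (matrixForm_single _ _ _)
  · have hGd := fun i j => (hG'.smooth i j).differentiableAt
    have e : partialDeriv l (fun z => G' z i j) 0 = metricDeriv G' 0 (EuclideanSpace.single l 1)
        (EuclideanSpace.single i 1) (EuclideanSpace.single j 1) := by
      simp [metricDeriv, partialDeriv]
    -- Metric compatibility: the derivative of the metric is the sum of two Koszul terms, and these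
    -- cancel against the two second-derivative terms of `T`.
    rw [e, metricDeriv_pullback hTc.contDiffAt hp h' hGd, hd2, hd2, hd0, hT0,
      map_neg, map_neg, neg_apply, hC, h.matrixForm_christoffelMap,
      matrixForm_symm h.symm.self_of_nhds, h.matrixForm_christoffelMap]
    simp only [koszul, ContinuousLinearEquiv.coe_coe]
    rw [h.metricDeriv_symm (L (EuclideanSpace.single i 1)) (L (EuclideanSpace.single l 1)),
      h.metricDeriv_symm (L (EuclideanSpace.single j 1)) (L (EuclideanSpace.single l 1)),
      h.metricDeriv_symm (L (EuclideanSpace.single l 1)) (L (EuclideanSpace.single j 1))]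
    ring

end NormalMap

/-! ### From sectional curvature to Ricci and scalar curvature. -/

section Positivity

variable {n : ℕ} {G : EuclideanSpace ℝ (Fin n) → Matrix (Fin n) (Fin n) ℝ}
  {y : EuclideanSpace ℝ (Fin n)}

theorem metricForm_eq_inner (h : G y = 1) (u v : EuclideanSpace ℝ (Fin n)) :
    metricForm G y u v = inner ℝ u v := by
  simp [metricForm, h, Matrix.one_apply, PiLp.inner_apply, mul_comm]

/-- Antisymmetry of the curvature in its first two slots. It handles dependent pairs, about which
positivity of sectional curvature says nothing. -/
theorem curvatureForm_self (u : EuclideanSpace ℝ (Fin n)) (c : ℝ) :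
    curvatureForm G y u (c • u) = 0 := by
  have hanti : ∀ i j k l, riemann G i j k l y = - riemann G j i k l y := by
    intro i j k l
    simp only [riemann, Finset.sum_sub_distrib]
    ring
  have h : curvatureForm G y u (c • u) = - curvatureForm G y u (c • u) := by
    conv_lhs => rw [curvatureForm, Finset.sum_comm]
    simp only [curvatureForm, ← Finset.sum_neg_distrib]
    refine Finset.sum_congr rfl fun i _ => Finset.sum_congr rfl fun j _ =>
      Finset.sum_congr rfl fun k _ => Finset.sum_congr rfl fun l _ =>
      Finset.sum_congr rfl fun m _ => ?_
    rw [hanti j i]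
    simp only [PiLp.smul_apply, smul_eq_mul]
    ring
  linarith

/-- Cauchy–Schwarz makes the denominator of the sectional curvature nonnegative, so a positive
quotient cannot have a negative numerator. -/
theorem curvatureForm_nonneg (h : G y = 1)
    (hpos : ∀ u v : EuclideanSpace ℝ (Fin n), LinearIndependent ℝ ![u, v] → 0 < sectional G y u v)
    {u : EuclideanSpace ℝ (Fin n)} (hu : u ≠ 0) (v : EuclideanSpace ℝ (Fin n)) :
    0 ≤ curvatureForm G y u v := by
  by_cases hi : LinearIndependent ℝ ![u, v]
  · have h1 := hpos u v hi
    have h2 : 0 ≤ metricForm G y u u * metricForm G y v v - metricForm G y u v ^ 2 := by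
      rw [metricForm_eq_inner h, metricForm_eq_inner h, metricForm_eq_inner h]
      have := real_inner_mul_inner_self_le u v
      nlinarith
    rw [sectional] at h1
    by_contra hc
    exact absurd h1 (not_lt.2 (div_nonpos_of_nonpos_of_nonneg (not_le.1 hc).le h2))
  · rw [LinearIndependent.pair_iff' hu] at hi
    push Not at hi
    obtain ⟨c, rfl⟩ := hi
    rw [curvatureForm_self]

/-- Positive sectional curvature implies `Ric ≥ 0`. -/
theorem ricci_nonneg (h : G y = 1)
    (hpos : ∀ u v : EuclideanSpace ℝ (Fin n), LinearIndependent ℝ ![u, v] → 0 < sectional G y u v)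
    (v : EuclideanSpace ℝ (Fin n)) : 0 ≤ ∑ j, ∑ k, ricci G j k y * v j * v k := by
  -- Since `G y = 1`, the standard basis is orthonormal and the Ricci form is a sum of curvature
  -- forms over it.
  have e : ∑ j, ∑ k, ricci G j k y * v j * v k
      = ∑ i, curvatureForm G y (EuclideanSpace.single i 1) v := by
    simp only [curvatureForm, h, Matrix.one_apply, ricci, Finset.sum_mul]
    rw [Finset.sum_congr rfl fun j _ => Finset.sum_comm, Finset.sum_comm]
    refine Finset.sum_congr rfl fun i _ => ?_
    simp
  rw [e]
  exact Finset.sum_nonneg fun i _ => curvatureForm_nonneg h hpos (by simp) v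

theorem scalar_nonneg (h : G y = 1)
    (hpos : ∀ u v : EuclideanSpace ℝ (Fin n), LinearIndependent ℝ ![u, v] → 0 < sectional G y u v) :
    0 ≤ scalar G y := by
  have e : scalar G y = ∑ j, ricci G j j y := by
    simp [scalar, h, Matrix.one_apply]
  rw [e]
  refine Finset.sum_nonneg fun a _ => ?_
  simpa using ricci_nonneg h hpos (EuclideanSpace.single a 1)

end Positivity

theorem surjective_of_injective_continuousLinearMap {n : ℕ}
    {D : EuclideanSpace ℝ (Fin n) →L[ℝ] EuclideanSpace ℝ (Fin n)} (hD : Function.Injective D) :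
    Function.Surjective D :=
  LinearMap.injective_iff_surjective (f := D.toLinearMap).1 hD

/-! ### Charts, transition maps and metric coefficients. -/

section Charts

variable {n : ℕ} {M : Type*} [MetricSpace M] [ChartedSpace (EuclideanSpace ℝ (Fin n)) M]

section Transition

variable {φ ψ : OpenPartialHomeomorph M (EuclideanSpace ℝ (Fin n))}
  (hφ : φ ∈ IsManifold.maximalAtlas (𝓡 n) ∞ M) (hψ : ψ ∈ IsManifold.maximalAtlas (𝓡 n) ∞ M)
  {y : EuclideanSpace ℝ (Fin n)}

include hφ

theorem contMDiffAt_chart_symm (hy : y ∈ φ.target) :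
    ContMDiffAt (𝓡 n) (𝓡 n) ∞ φ.symm y :=
  (contMDiffOn_symm_of_mem_maximalAtlas hφ).contMDiffAt (φ.open_target.mem_nhds hy)

theorem contMDiffAt_chart {x : M} (hx : x ∈ φ.source) : ContMDiffAt (𝓡 n) (𝓡 n) ∞ φ x :=
  (contMDiffOn_of_mem_maximalAtlas hφ).contMDiffAt (φ.open_source.mem_nhds hx)

theorem mdifferentiableAt_chart_symm (hy : y ∈ φ.target) :
    MDifferentiableAt (𝓡 n) (𝓡 n) φ.symm y :=
  (contMDiffAt_chart_symm hφ hy).mdifferentiableAt (by simp)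

theorem mdifferentiableAt_chart {x : M} (hx : x ∈ φ.source) :
    MDifferentiableAt (𝓡 n) (𝓡 n) φ x :=
  (contMDiffAt_chart hφ hx).mdifferentiableAt (by simp)

theorem mfderiv_chart_symm_apply (hy : y ∈ φ.target) (u : EuclideanSpace ℝ (Fin n)) :
    mfderiv (𝓡 n) (𝓡 n) φ (φ.symm y) (mfderiv (𝓡 n) (𝓡 n) φ.symm y u) = u := by
  have h1 := mfderiv_comp y (mdifferentiableAt_chart hφ (φ.map_target hy))
    (mdifferentiableAt_chart_symm hφ hy)
  have h2 : φ ∘ φ.symm =ᶠ[nhds y] id := by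
    filter_upwards [φ.open_target.mem_nhds hy] with z hz using φ.right_inv hz
  rw [h2.mfderiv_eq, mfderiv_id] at h1
  exact (congrArg (fun L => L u) h1).symm

theorem mfderiv_chart_symm_injective (hy : y ∈ φ.target) {u : EuclideanSpace ℝ (Fin n)}
    (hu : mfderiv (𝓡 n) (𝓡 n) φ.symm y u = 0) : u = 0 := by
  rw [← mfderiv_chart_symm_apply hφ hy u, hu]
  exact map_zero _

/-- In equal finite dimensions a one-sided inverse is two-sided. -/
theorem mfderiv_chart_symm_chart_apply (hy : y ∈ φ.target)
    (v : TangentSpace (𝓡 n) (φ.symm y)) :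
    mfderiv (𝓡 n) (𝓡 n) φ.symm y (mfderiv (𝓡 n) (𝓡 n) φ (φ.symm y) v) = v := by
  have hs : Function.Surjective (mfderiv (𝓡 n) (𝓡 n) φ.symm y : EuclideanSpace ℝ (Fin n) →
      EuclideanSpace ℝ (Fin n)) := by
    set D : EuclideanSpace ℝ (Fin n) →L[ℝ] EuclideanSpace ℝ (Fin n) :=
      mfderiv (𝓡 n) (𝓡 n) φ.symm y with hD
    have : Function.Injective D :=
      (injective_iff_map_eq_zero _).2 fun u hu => mfderiv_chart_symm_injective hφ hy hu
    exact surjective_of_injective_continuousLinearMap this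
  obtain ⟨u, rfl⟩ := hs v
  exact congrArg _ (mfderiv_chart_symm_apply hφ hy u)

include hψ

theorem contDiffAt_transition (hy : y ∈ φ.target) (hy' : φ.symm y ∈ ψ.source) :
    ContDiffAt ℝ ∞ (ψ ∘ φ.symm) y :=
  contMDiffAt_iff_contDiffAt.1
    ((contMDiffAt_chart hψ hy').comp y (contMDiffAt_chart_symm hφ hy))

omit [ChartedSpace (EuclideanSpace ℝ (Fin n)) M] hφ hψ in
theorem eventually_transition (hy : y ∈ φ.target) (hy' : φ.symm y ∈ ψ.source) :
    ∀ᶠ z in nhds y, z ∈ φ.target ∧ φ.symm z ∈ ψ.source :=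
  Filter.Eventually.and (φ.open_target.mem_nhds hy)
    ((φ.continuousAt_symm hy).eventually (ψ.open_source.mem_nhds hy'))

/-- Chain rule for `φ⁻¹ = ψ⁻¹ ∘ (ψ ∘ φ⁻¹)`. The equality is read in the model space because the base
points agree only propositionally. -/
theorem mfderiv_transition (hy : y ∈ φ.target) (hy' : φ.symm y ∈ ψ.source)
    (u : EuclideanSpace ℝ (Fin n)) :
    (mfderiv (𝓡 n) (𝓡 n) φ.symm y u : EuclideanSpace ℝ (Fin n))
      = mfderiv (𝓡 n) (𝓡 n) ψ.symm (ψ (φ.symm y)) (fderiv ℝ (ψ ∘ φ.symm) y u) := by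
  have h1 : φ.symm =ᶠ[nhds y] ψ.symm ∘ (ψ ∘ φ.symm) := by
    filter_upwards [eventually_transition hy hy'] with z hz
    exact (ψ.left_inv hz.2).symm
  have h2 : MDifferentiableAt (𝓡 n) (𝓡 n) (ψ ∘ φ.symm) y :=
    (mdifferentiableAt_chart hψ hy').comp y (mdifferentiableAt_chart_symm hφ hy)
  have h3 := mfderiv_comp y (mdifferentiableAt_chart_symm hψ (ψ.map_source hy')) h2
  rw [mfderiv_eq_fderiv] at h3
  have h4 := h1.mfderiv_eq (I := 𝓡 n) (I' := 𝓡 n)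
  exact (congrArg (fun L : EuclideanSpace ℝ (Fin n) →L[ℝ] EuclideanSpace ℝ (Fin n) => L u) h4).trans
    (congrArg (fun L : EuclideanSpace ℝ (Fin n) →L[ℝ] EuclideanSpace ℝ (Fin n) => L u) h3)

end Transition

variable [RiemannianBundle (fun x : M => TangentSpace (𝓡 n) x)]

/-- The scalar product at `x`, as a function of two vectors of the model space. -/
def tangentInner (x : M) (u v : EuclideanSpace ℝ (Fin n)) : ℝ :=
  inner ℝ (show TangentSpace (𝓡 n) x from u) (show TangentSpace (𝓡 n) x from v)

/-- Once the vectors are taken in the model space, the base point can be rewritten without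
disturbing their types. -/
theorem tangentInner_eq (x : M) (u v : TangentSpace (𝓡 n) x) :
    inner ℝ u v = tangentInner x u v := rfl

theorem matrixForm_metricCoeff (φ : OpenPartialHomeomorph M (EuclideanSpace ℝ (Fin n)))
    (y u v : EuclideanSpace ℝ (Fin n)) :
    matrixForm (metricCoeff φ y) u v
      = inner ℝ (mfderiv (𝓡 n) (𝓡 n) φ.symm y u : TangentSpace (𝓡 n) (φ.symm y))
        (mfderiv (𝓡 n) (𝓡 n) φ.symm y v) := by
  have hu : ∀ u : EuclideanSpace ℝ (Fin n),
      (mfderiv (𝓡 n) (𝓡 n) φ.symm y u : TangentSpace (𝓡 n) (φ.symm y))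
      = ∑ i, u i • (mfderiv (𝓡 n) (𝓡 n) φ.symm y (EuclideanSpace.single i (1 : ℝ)) :
        TangentSpace (𝓡 n) (φ.symm y)) := by
    intro u
    have : u = ∑ i, u i • EuclideanSpace.single i (1 : ℝ) := by
      ext j
      simp [Finset.sum_apply, Pi.single_apply]
    conv_lhs => rw [this]
    exact (map_sum _ _ _).trans (Finset.sum_congr rfl fun i _ => map_smul _ _ _)
  rw [hu u, hu v, sum_inner, matrixForm_apply]
  refine Finset.sum_congr rfl fun i _ => ?_
  rw [inner_sum]
  refine Finset.sum_congr rfl fun j _ => ?_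
  rw [real_inner_smul_left, real_inner_smul_right, metricCoeff, Matrix.of_apply]
  ring

theorem metricCoeff_symm (φ : OpenPartialHomeomorph M (EuclideanSpace ℝ (Fin n)))
    (y : EuclideanSpace ℝ (Fin n)) (i j : Fin n) : metricCoeff φ y i j = metricCoeff φ y j i :=
  real_inner_comm (F := TangentSpace (𝓡 n) (φ.symm y)) _ _

variable {φ ψ : OpenPartialHomeomorph M (EuclideanSpace ℝ (Fin n))}
  (hφ : φ ∈ IsManifold.maximalAtlas (𝓡 n) ∞ M) (hψ : ψ ∈ IsManifold.maximalAtlas (𝓡 n) ∞ M)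
  {y : EuclideanSpace ℝ (Fin n)}

include hφ hψ in
theorem isPullbackAt_transition (hy : y ∈ φ.target) (hy' : φ.symm y ∈ ψ.source) :
    IsPullbackAt (metricCoeff φ) (metricCoeff ψ) (ψ ∘ φ.symm) y := by
  intro u v
  rw [matrixForm_metricCoeff, matrixForm_metricCoeff, tangentInner_eq, tangentInner_eq,
    mfderiv_transition hφ hψ hy hy', mfderiv_transition hφ hψ hy hy', Function.comp_apply,
    ψ.left_inv hy']

variable [IsManifold (𝓡 n) ∞ M] [IsContMDiffRiemannianBundle (𝓡 n) ∞ (EuclideanSpace ℝ (Fin n))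
      (fun x : M => TangentSpace (𝓡 n) x)]
include hφ

/-- The coordinate fields are the tangent map of `φ.symm` applied to constant fields, hence smooth
sections, and the bundle metric is smooth. -/
theorem contDiffAt_metricCoeff (hy : y ∈ φ.target) (i j : Fin n) :
    ContDiffAt ℝ ∞ (fun z => metricCoeff φ z i j) y := by
  have hsec : ∀ i : Fin n, ContMDiffAt (𝓡 n) (𝓡 n).tangent ∞
      (fun z => (⟨φ.symm z, mfderiv (𝓡 n) (𝓡 n) φ.symm z (EuclideanSpace.single i (1 : ℝ))⟩ :
        TangentBundle (𝓡 n) M)) y := by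
    intro i
    have : IsManifold (𝓡 n) 1 M := IsManifold.of_le (n := ∞) (by simp)
    have h1 := (contMDiffOn_symm_of_mem_maximalAtlas hφ).contMDiffOn_tangentMapWithin
      (m := ∞) (by simp) φ.open_target.uniqueMDiffOn
    have h2 : ContMDiff (𝓡 n) (𝓡 n).tangent ∞ (fun z : EuclideanSpace ℝ (Fin n) =>
        (⟨z, EuclideanSpace.single i (1 : ℝ)⟩ : TangentBundle (𝓡 n) (EuclideanSpace ℝ (Fin n)))) :=
      contMDiff_vectorSpace_iff_contDiff.2 contDiff_const
    have h3 := (h1.comp (s := φ.target) h2.contMDiffOn fun z hz => hz).contMDiffAt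
      (φ.open_target.mem_nhds hy)
    refine h3.congr_of_eventuallyEq ?_
    filter_upwards [φ.open_target.mem_nhds hy] with z hz
    simp [tangentMapWithin, mfderivWithin_of_isOpen φ.open_target hz]
  exact contMDiffAt_iff_contDiffAt.1 ((hsec i).inner_bundle (hsec j))

theorem isMetricNear_metricCoeff (hy : y ∈ φ.target) : IsMetricNear (metricCoeff φ) y where
  smooth i j := by
    filter_upwards [φ.open_target.mem_nhds hy] with z hz using contDiffAt_metricCoeff hφ hz i j
  symm := Filter.Eventually.of_forall fun z i j => metricCoeff_symm φ z i j
  posDef := by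
    refine Matrix.PosDef.of_dotProduct_mulVec_pos ?_ fun x hx => ?_
    · ext i j
      exact metricCoeff_symm φ y j i
    · open Matrix in
      have e : star x ⬝ᵥ metricCoeff φ y *ᵥ x
          = matrixForm (metricCoeff φ y) (WithLp.toLp 2 x) (WithLp.toLp 2 x) := by
        simp only [matrixForm_apply, dotProduct, Matrix.mulVec, Finset.mul_sum, star_trivial]
        exact Finset.sum_congr rfl fun i _ => Finset.sum_congr rfl fun j _ => by ring
      rw [e, matrixForm_metricCoeff]
      refine real_inner_self_pos.2 fun h0 => hx ?_
      have := mfderiv_chart_symm_injective hφ hy h0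
      simpa using this

end Charts

/-! ### Normal charts, invariance of the scalar curvature, and the gradient in a chart. -/

section Soliton

variable {n : ℕ} {M : Type*} [MetricSpace M] [ChartedSpace (EuclideanSpace ℝ (Fin n)) M]
  [IsManifold (𝓡 n) ∞ M]

theorem trans_mem_maximalAtlas {φ : OpenPartialHomeomorph M (EuclideanSpace ℝ (Fin n))}
    (hφ : φ ∈ IsManifold.maximalAtlas (𝓡 n) ∞ M)
    {e : OpenPartialHomeomorph (EuclideanSpace ℝ (Fin n)) (EuclideanSpace ℝ (Fin n))}
    (he : e ∈ contDiffGroupoid ∞ (𝓡 n)) : φ.trans e ∈ IsManifold.maximalAtlas (𝓡 n) ∞ M := by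
  intro ψ hψ
  have hψ' := StructureGroupoid.subset_maximalAtlas (contDiffGroupoid ∞ (𝓡 n)) hψ
  have h1 := StructureGroupoid.compatible_of_mem_maximalAtlas hφ hψ'
  have h2 := StructureGroupoid.compatible_of_mem_maximalAtlas hψ' hφ
  constructor
  · rw [OpenPartialHomeomorph.trans_symm_eq_symm_trans_symm, OpenPartialHomeomorph.trans_assoc]
    exact StructureGroupoid.trans _ (StructureGroupoid.symm _ he) h1
  · rw [← OpenPartialHomeomorph.trans_assoc]
    exact StructureGroupoid.trans _ h2 he

/-- A map with invertible derivative is locally a change of coordinates. -/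
theorem exists_mem_contDiffGroupoid {T : EuclideanSpace ℝ (Fin n) → EuclideanSpace ℝ (Fin n)}
    (hT : ContDiff ℝ ∞ T) {x : EuclideanSpace ℝ (Fin n)}
    {L : EuclideanSpace ℝ (Fin n) ≃L[ℝ] EuclideanSpace ℝ (Fin n)}
    (hL : HasFDerivAt T (L : EuclideanSpace ℝ (Fin n) →L[ℝ] EuclideanSpace ℝ (Fin n)) x) :
    ∃ e ∈ contDiffGroupoid ∞ (𝓡 n), x ∈ e.source ∧ ∀ z, e z = T z := by
  set e := hT.contDiffAt.toOpenPartialHomeomorph T hL (by simp) with he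
  -- Membership in the groupoid needs the inverse to be smooth on the whole target, so the source is
  -- cut down to the open set where the differential is invertible.
  set U : Set (EuclideanSpace ℝ (Fin n)) := {z | fderiv ℝ T z ∈
    Set.range (ContinuousLinearEquiv.toContinuousLinearMap :
      (EuclideanSpace ℝ (Fin n) ≃L[ℝ] EuclideanSpace ℝ (Fin n)) → _)} with hU
  have hUo : IsOpen U := (ContinuousLinearEquiv.isOpen).preimage (hT.continuous_fderiv (by simp))
  have hxU : x ∈ U := ⟨L, hL.fderiv.symm⟩
  have hec : ∀ z, (e.restr U) z = T z := fun z => rfl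
  have hs : (e.restr U).source = e.source ∩ U := by
    rw [OpenPartialHomeomorph.restr_source, hUo.interior_eq]
  refine ⟨e.restr U, ?_, ?_, hec⟩
  · rw [contDiffGroupoid, mem_groupoid_of_pregroupoid]
    refine ⟨hT.contDiffOn, fun z hz => ContDiffAt.contDiffWithinAt ?_⟩
    have hz' : z ∈ (e.restr U).target := hz.1
    obtain ⟨L', hL'⟩ : (e.restr U).symm z ∈ U := (hs ▸ (e.restr U).map_target hz').2
    have hd : HasFDerivAt (e.restr U)
        (L' : EuclideanSpace ℝ (Fin n) →L[ℝ] EuclideanSpace ℝ (Fin n)) ((e.restr U).symm z) := by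
      rw [hL']
      exact (hT.differentiable (by simp) _).hasFDerivAt
    exact (e.restr U).contDiffAt_symm hz' hd hT.contDiffAt
  · rw [hs]
    exact ⟨hT.contDiffAt.mem_toOpenPartialHomeomorph_source hL (by simp), hxU⟩

variable [RiemannianBundle (fun x : M => TangentSpace (𝓡 n) x)]
  [IsContMDiffRiemannianBundle (𝓡 n) ∞ (EuclideanSpace ℝ (Fin n))
      (fun x : M => TangentSpace (𝓡 n) x)]

/-- Charts in which the metric is Euclidean to first order at a given point. -/
theorem exists_normal_chart (x : M) :
    ∃ φ ∈ IsManifold.maximalAtlas (𝓡 n) ∞ M, x ∈ φ.source ∧ φ x = 0 ∧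
      IsNormalAt (metricCoeff φ) 0 := by
  set ψ := chartAt (EuclideanSpace ℝ (Fin n)) x
  have hψ : ψ ∈ IsManifold.maximalAtlas (𝓡 n) ∞ M := IsManifold.chart_mem_maximalAtlas x
  have hx : x ∈ ψ.source := mem_chart_source _ x
  obtain ⟨T, L, hT, hT0, hL, hN⟩ := (isMetricNear_metricCoeff hψ (ψ.map_source hx)).exists_normal
  obtain ⟨e, he, h0, heT⟩ := exists_mem_contDiffGroupoid hT hL
  -- The normal chart is `ψ` followed by a local inverse of `T`.
  have hφ := trans_mem_maximalAtlas hψ (StructureGroupoid.symm _ he)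
  have hex : e 0 = ψ x := by rw [heT, hT0]
  have hxs : x ∈ (ψ.trans e.symm).source := by
    rw [OpenPartialHomeomorph.trans_source]
    refine ⟨hx, ?_⟩
    change ψ x ∈ e.target
    rw [← hex]
    exact e.map_source h0
  have hφx : (ψ.trans e.symm) x = 0 := by
    rw [OpenPartialHomeomorph.trans_apply, ← hex, e.left_inv h0]
  refine ⟨_, hφ, hxs, hφx, ?_⟩
  have h0t : (0 : EuclideanSpace ℝ (Fin n)) ∈ (ψ.trans e.symm).target := by
    rw [← hφx]
    exact (ψ.trans e.symm).map_source hxs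
  have h0s : (ψ.trans e.symm).symm 0 ∈ ψ.source := by
    rw [← hφx, (ψ.trans e.symm).left_inv hxs]
    exact hx
  have hev : ψ ∘ (ψ.trans e.symm).symm =ᶠ[nhds 0] T := by
    filter_upwards [(ψ.trans e.symm).open_target.mem_nhds h0t] with z hz
    rw [Function.comp_apply, OpenPartialHomeomorph.coe_trans_symm, Function.comp_apply,
      OpenPartialHomeomorph.symm_symm, ψ.right_inv, heT]
    rw [OpenPartialHomeomorph.trans_target] at hz
    exact hz.2
  refine hN _ (isMetricNear_metricCoeff hφ h0t) ?_
  filter_upwards [eventually_transition h0t h0s, hev.eventuallyEq_nhds] with z hz hz' u v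
  have := isPullbackAt_transition hφ hψ hz.1 hz.2 u v
  rw [hz'.fderiv_eq, hz'.self_of_nhds] at this
  exact this

variable {f : M → ℝ} (hf : IsGradientRicciSoliton n f)
  {φ ψ : OpenPartialHomeomorph M (EuclideanSpace ℝ (Fin n))}
  (hφ : φ ∈ IsManifold.maximalAtlas (𝓡 n) ∞ M) (hψ : ψ ∈ IsManifold.maximalAtlas (𝓡 n) ∞ M)
  {y : EuclideanSpace ℝ (Fin n)}

omit [IsManifold (𝓡 n) ∞ M] [RiemannianBundle (fun x : M => TangentSpace (𝓡 n) x)]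
  [IsContMDiffRiemannianBundle (𝓡 n) ∞ (EuclideanSpace ℝ (Fin n))
      (fun x : M => TangentSpace (𝓡 n) x)] in
theorem smoothNear_comp_chart_symm (hf : ContMDiff (𝓡 n) 𝓘(ℝ, ℝ) ∞ f)
    (hφ : φ ∈ IsManifold.maximalAtlas (𝓡 n) ∞ M) (hy : y ∈ φ.target) :
    SmoothNear (fun z => f (φ.symm z)) y := by
  filter_upwards [φ.open_target.mem_nhds hy] with z hz
  exact contMDiffAt_iff_contDiffAt.1 ((hf _).comp z (contMDiffAt_chart_symm hφ hz))

include hf hφ hψ in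
/-- On a soliton, the scalar curvature does not depend on the chart. -/
theorem IsGradientRicciSoliton.scalar_eq {x : M} (hx : x ∈ φ.source) (hx' : x ∈ ψ.source) :
    scalar (metricCoeff φ) (φ x) = scalar (metricCoeff ψ) (ψ x) := by
  have hy := φ.map_source hx
  have hxy : φ.symm (φ x) = x := φ.left_inv hx
  have hy' : φ.symm (φ x) ∈ ψ.source := by rwa [hxy]
  have hT := contDiffAt_transition hφ hψ hy hy'
  have hTy : (ψ ∘ φ.symm) (φ x) = ψ x := by rw [Function.comp_apply, hxy]
  have hp : ∀ᶠ z in nhds (φ x), IsPullbackAt (metricCoeff φ) (metricCoeff ψ) (ψ ∘ φ.symm) z :=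
    (eventually_transition hy hy').mono fun z hz => isPullbackAt_transition hφ hψ hz.1 hz.2
  have hyt : ψ x ∈ ψ.target := ψ.map_source hx'
  have hG := isMetricNear_metricCoeff hψ hyt
  have hF := smoothNear_comp_chart_symm hf.smooth hψ hyt
  rw [← hTy] at hG hF
  have hsurj : Function.Surjective (fderiv ℝ (ψ ∘ φ.symm) (φ x)) := by
    refine surjective_of_injective_continuousLinearMap ((injective_iff_map_eq_zero _).2 ?_)
    intro u hu
    refine mfderiv_chart_symm_injective hφ hy ?_
    have h := mfderiv_transition hφ hψ hy hy' u
    rw [hu] at h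
    exact h.trans (map_zero _)
  have he : (fun z => f (φ.symm z)) =ᶠ[nhds (φ x)] (fun z => f (ψ.symm z)) ∘ (ψ ∘ φ.symm) := by
    filter_upwards [eventually_transition hy hy'] with z hz
    simp [ψ.left_inv hz.2]
  have key := laplacian_pullback hT hp hG (isMetricNear_metricCoeff hφ hy) hsurj hF
    (smoothNear_comp_chart_symm hf.smooth hφ hy) he
  rw [hTy] at key
  rw [scalar, scalar]
  -- The soliton equation turns the trace of Ricci into the Laplacian of `f`.
  simp_rw [hf.ricci_eq φ hφ _ hy, hf.ricci_eq ψ hψ _ hyt]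
  exact key

include hf hφ in
theorem IsGradientRicciSoliton.scalarCurvature_eq {x : M} (hx : x ∈ φ.source) :
    scalarCurvature n x = scalar (metricCoeff φ) (φ x) :=
  hf.scalar_eq (IsManifold.chart_mem_maximalAtlas x) hφ (mem_chart_source _ x) hx

/-- The components of the gradient of `F`. -/
def gradVec (G : EuclideanSpace ℝ (Fin n) → Matrix (Fin n) (Fin n) ℝ)
    (F : EuclideanSpace ℝ (Fin n) → ℝ) (y : EuclideanSpace ℝ (Fin n)) :
    EuclideanSpace ℝ (Fin n) :=
  WithLp.toLp 2 fun i => ∑ j, (G y)⁻¹ i j * partialDeriv j F y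

theorem matrixForm_gradVec {G : EuclideanSpace ℝ (Fin n) → Matrix (Fin n) (Fin n) ℝ}
    (hG : (G y).det ≠ 0) (hs : ∀ i j, G y i j = G y j i)
    (F : EuclideanSpace ℝ (Fin n) → ℝ) (u : EuclideanSpace ℝ (Fin n)) :
    matrixForm (G y) (gradVec G F y) u = fderiv ℝ F y u := by
  have hm := Matrix.mulVec_mulVec (fun j => partialDeriv j F y) (G y) (G y)⁻¹
  rw [Matrix.mul_nonsing_inv _ (isUnit_iff_ne_zero.2 hG), Matrix.one_mulVec] at hm
  rw [fderiv_eq_sum_partialDeriv, matrixForm_apply, Finset.sum_comm]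
  refine Finset.sum_congr rfl fun j _ => ?_
  rw [← congrFun hm j]
  conv_rhs => rw [Matrix.mulVec, dotProduct, Finset.mul_sum]
  refine Finset.sum_congr rfl fun i _ => ?_
  rw [hs i j]
  change G y j i * Matrix.mulVec (G y)⁻¹ _ i * u j = _
  ring

include hφ in
theorem mfderiv_chart_symm_gradVec (hf : ContMDiff (𝓡 n) 𝓘(ℝ, ℝ) ∞ f) (hy : y ∈ φ.target) :
    mfderiv (𝓡 n) (𝓡 n) φ.symm y (gradVec (metricCoeff φ) (fun z => f (φ.symm z)) y)
      = grad n f (φ.symm y) := by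
  refine ext_inner_right ℝ fun v => ?_
  rw [inner_grad, ← mfderiv_chart_symm_chart_apply hφ hy v]
  set u : EuclideanSpace ℝ (Fin n) := mfderiv (𝓡 n) (𝓡 n) φ (φ.symm y) v
  have hG := isMetricNear_metricCoeff hφ hy
  refine (matrixForm_metricCoeff φ y _ u).symm.trans ?_
  rw [matrixForm_gradVec hG.det_ne_zero hG.symm.self_of_nhds]
  have h := mfderiv_comp y ((hf (φ.symm y)).mdifferentiableAt (by simp))
    (mdifferentiableAt_chart_symm hφ hy)
  have h2 : mfderiv (𝓡 n) 𝓘(ℝ, ℝ) (f ∘ φ.symm) y = fderiv ℝ (fun z => f (φ.symm z)) y :=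
    mfderiv_eq_fderiv
  rw [h2] at h
  exact congrArg (fun L => L u) h

include hφ in
theorem norm_grad_sq (hf : ContMDiff (𝓡 n) 𝓘(ℝ, ℝ) ∞ f) {x : M} (hx : x ∈ φ.source) :
    ‖grad n f x‖ ^ 2 = ∑ i, ∑ j, (metricCoeff φ (φ x))⁻¹ i j
      * (partialDeriv i (fun z => f (φ.symm z)) (φ x)
        * partialDeriv j (fun z => f (φ.symm z)) (φ x)) := by
  have hy := φ.map_source hx
  have hG := isMetricNear_metricCoeff hφ hy
  have h1 : ‖grad n f x‖ = ‖grad n f (φ.symm (φ x))‖ := by rw [φ.left_inv hx]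
  rw [h1, ← mfderiv_chart_symm_gradVec hφ hf hy, ← real_inner_self_eq_norm_sq,
    ← matrixForm_metricCoeff, matrixForm_gradVec hG.det_ne_zero hG.symm.self_of_nhds,
    fderiv_eq_sum_partialDeriv]
  refine Finset.sum_congr rfl fun i _ => ?_
  rw [gradVec, Finset.sum_mul]
  exact Finset.sum_congr rfl fun j _ => by ring

include hφ in
theorem mfderiv_chart_grad (hf : ContMDiff (𝓡 n) 𝓘(ℝ, ℝ) ∞ f) {x : M} (hx : x ∈ φ.source) :
    mfderiv (𝓡 n) (𝓡 n) φ x (grad n f x)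
      = gradVec (metricCoeff φ) (fun z => f (φ.symm z)) (φ x) := by
  have hy := φ.map_source hx
  have h := mfderiv_chart_symm_apply hφ hy (gradVec (metricCoeff φ) (fun z => f (φ.symm z)) (φ x))
  rw [mfderiv_chart_symm_gradVec hφ hf hy] at h
  -- The base point is generalized because `φ.symm (φ x)` equals `x` only propositionally.
  have e : ∀ x', x' = x → (mfderiv (𝓡 n) (𝓡 n) φ x' (grad n f x') : EuclideanSpace ℝ (Fin n))
      = mfderiv (𝓡 n) (𝓡 n) φ x (grad n f x) := by
    rintro x' rfl
    rfl
  exact (e _ (φ.left_inv hx)).symm.trans h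

end Soliton

/-! ### Convexity of the potential along geodesics and the angle estimate. -/

section Curves

variable {n : ℕ} {M : Type*} [MetricSpace M] [ChartedSpace (EuclideanSpace ℝ (Fin n)) M]
  {f : M → ℝ} {φ : OpenPartialHomeomorph M (EuclideanSpace ℝ (Fin n))}

theorem hasDerivAt_comp_eq_sum {H : EuclideanSpace ℝ (Fin n) → ℝ}
    {c : ℝ → EuclideanSpace ℝ (Fin n)} {c' : EuclideanSpace ℝ (Fin n)} {t : ℝ}
    (hH : DifferentiableAt ℝ H (c t)) (hc : HasDerivAt c c' t) :
    HasDerivAt (fun τ => H (c τ)) (∑ i, c' i * partialDeriv i H (c t)) t := by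
  rw [← fderiv_eq_sum_partialDeriv]
  exact hH.hasFDerivAt.comp_hasDerivAt t hc

theorem hasDerivAt_chart_comp (hφ : φ ∈ IsManifold.maximalAtlas (𝓡 n) ∞ M) {γ : ℝ → M} {t : ℝ}
    {v : TangentSpace (𝓡 n) (γ t)} (ht : γ t ∈ φ.source)
    (hγ : HasMFDerivAt 𝓘(ℝ, ℝ) (𝓡 n) γ t ((1 : ℝ →L[ℝ] ℝ).smulRight v)) :
    HasDerivAt (fun τ => φ (γ τ)) (mfderiv (𝓡 n) (𝓡 n) φ (γ t) v) t := by
  have h := ((mdifferentiableAt_chart hφ ht).hasMFDerivAt.comp t hγ)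
  have h2 : HasFDerivAt (fun τ => φ (γ τ))
      ((show EuclideanSpace ℝ (Fin n) →L[ℝ] EuclideanSpace ℝ (Fin n) from
        mfderiv (𝓡 n) (𝓡 n) φ (γ t)).comp ((1 : ℝ →L[ℝ] ℝ).smulRight
          (show EuclideanSpace ℝ (Fin n) from v))) t := hasMFDerivAt_iff_hasFDerivAt.1 h
  refine h2.hasDerivAt.congr_deriv ?_
  change mfderiv (𝓡 n) (𝓡 n) φ (γ t) ((1 : ℝ) • v) = _
  rw [one_smul]

variable [RiemannianBundle (fun x : M => TangentSpace (𝓡 n) x)]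

theorem hasDerivAt_comp_of_hasMFDerivAt (hf : ContMDiff (𝓡 n) 𝓘(ℝ, ℝ) ∞ f) {γ : ℝ → M} {t : ℝ}
    {v : TangentSpace (𝓡 n) (γ t)}
    (hγ : HasMFDerivAt 𝓘(ℝ, ℝ) (𝓡 n) γ t ((1 : ℝ →L[ℝ] ℝ).smulRight v)) :
    HasDerivAt (fun τ => f (γ τ)) (inner ℝ (grad n f (γ t)) v) t := by
  have h := (((hf (γ t)).mdifferentiableAt (by simp)).hasMFDerivAt.comp t hγ)
  have h2 : HasFDerivAt (fun τ => f (γ τ))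
      ((show EuclideanSpace ℝ (Fin n) →L[ℝ] ℝ from
        mfderiv (𝓡 n) 𝓘(ℝ, ℝ) f (γ t)).comp ((1 : ℝ →L[ℝ] ℝ).smulRight
          (show EuclideanSpace ℝ (Fin n) from v))) t := hasMFDerivAt_iff_hasFDerivAt.1 h
  refine h2.hasDerivAt.congr_deriv ?_
  rw [inner_grad]
  change mfderiv (𝓡 n) 𝓘(ℝ, ℝ) f (γ t) ((1 : ℝ) • v) = _
  rw [one_smul]

theorem norm_grad_mul_cos_normalAngle {γ : ℝ → M} {t : ℝ} (hv : ‖velocity n γ t‖ = 1) :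
    ‖grad n f (γ t)‖ * Real.cos (normalAngle n f γ t)
      = inner ℝ (grad n f (γ t)) (velocity n γ t) := by
  -- At a critical point both sides vanish, whatever default value the angle takes.
  by_cases hg : grad n f (γ t) = 0
  · simp [hg]
  · have hg' : ‖grad n f (γ t)‖ ≠ 0 := norm_ne_zero_iff.2 hg
    have hN : ‖normal n f (γ t)‖ = 1 := by
      rw [normal, norm_smul, norm_inv, norm_norm, inv_mul_cancel₀ hg']
    have h := InnerProductGeometry.cos_angle_mul_norm_mul_norm (normal n f (γ t)) (velocity n γ t)
    rw [hN, hv, mul_one, mul_one, normal, real_inner_smul_left] at h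
    rw [normalAngle, normal, h, mul_inv_cancel_left₀ hg']

variable [IsManifold (𝓡 n) ∞ M]
  [IsContMDiffRiemannianBundle (𝓡 n) ∞ (EuclideanSpace ℝ (Fin n))
      (fun x : M => TangentSpace (𝓡 n) x)]
  (hf : IsGradientRicciSoliton n f) (hpos : HasPositiveSectionalCurvature n M)

include hf hpos

theorem IsGradientRicciSoliton.scalarCurvature_nonneg (x : M) : 0 ≤ scalarCurvature n x := by
  obtain ⟨φ, hφ, hx, hx0, hN⟩ := exists_normal_chart (n := n) x
  rw [hf.scalarCurvature_eq hφ hx, hx0]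
  exact scalar_nonneg hN.eq_one (hpos φ hφ 0 (hx0 ▸ φ.map_source hx))

/-- The potential of a soliton with positive curvature is convex along geodesics. -/
theorem IsGradientRicciSoliton.deriv_deriv_comp_geodesic_nonneg {γ : ℝ → M} {t : ℝ}
    (hγ : ContMDiffAt 𝓘(ℝ, ℝ) (𝓡 n) ∞ γ t) (hgeo : GeodesicEquationAt n γ t) :
    0 ≤ deriv (deriv fun τ => f (γ τ)) t := by
  obtain ⟨φ, hφ, hx, hx0, hN⟩ := exists_normal_chart (n := n) (γ t)
  have h0 : (0 : EuclideanSpace ℝ (Fin n)) ∈ φ.target := hx0 ▸ φ.map_source hx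
  set c : ℝ → EuclideanSpace ℝ (Fin n) := fun τ => φ (γ τ) with hc
  have hcs : ContDiffAt ℝ ∞ c t :=
    contMDiffAt_iff_contDiffAt.1 ((contMDiffAt_chart hφ hx).comp t hγ)
  have hct : c t = 0 := hx0
  set F : EuclideanSpace ℝ (Fin n) → ℝ := fun z => f (φ.symm z) with hFd
  have hF : SmoothNear F (c t) := hct ▸ smoothNear_comp_chart_symm hf.smooth hφ h0
  have hcd : ∀ᶠ τ in nhds t, HasDerivAt c (deriv c τ) τ :=
    ((hcs.of_le (m := 1) (by simp)).eventually (by simp)).mono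
      fun τ hτ => (hτ.differentiableAt (by simp)).hasDerivAt
  have hcd2 : HasDerivAt (deriv c) (deriv (deriv c) t) t :=
    ((ContDiffAt.derivWithin (m := ∞) hcs (by simp)).differentiableAt (by simp)).hasDerivAt
  have hcomp : ∀ {c : ℝ → EuclideanSpace ℝ (Fin n)} {c' : EuclideanSpace ℝ (Fin n)} {τ : ℝ},
      HasDerivAt c c' τ → ∀ i, HasDerivAt (fun τ => c τ i) (c' i) τ := fun h i =>
    (EuclideanSpace.proj i : EuclideanSpace ℝ (Fin n) →L[ℝ] ℝ).hasFDerivAt.comp_hasDerivAt _ h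
  have hci : ∀ᶠ τ in nhds t, ∀ i, deriv (fun τ => c τ i) τ = deriv c τ i :=
    hcd.mono fun τ hτ i => (hcomp hτ i).deriv
  have e1 : (fun τ => f (γ τ)) =ᶠ[nhds t] fun τ => F (c τ) := by
    filter_upwards [hγ.continuousAt.eventually (φ.open_source.mem_nhds hx)] with τ hτ
    simp [hFd, hc, φ.left_inv hτ]
  have e2 : deriv (fun τ => f (γ τ)) =ᶠ[nhds t]
      fun τ => ∑ i, deriv c τ i * partialDeriv i F (c τ) := by
    filter_upwards [e1.eventuallyEq_nhds, hcd,
      hcs.continuousAt.eventually hF.eventually_differentiableAt] with τ h1 h2 h3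
    rw [h1.deriv_eq, (hasDerivAt_comp_eq_sum h3 h2).deriv]
  -- The Christoffel symbols vanish at the centre, so there the geodesic equation says that the
  -- coordinate acceleration is zero.
  have hgeo' : ∀ k, deriv (deriv c) t k = 0 := by
    intro k
    have h := hgeo φ hφ hx k
    have e : (deriv fun τ => c τ k) =ᶠ[nhds t] fun τ => deriv c τ k := hci.mono fun τ h => h k
    rw [e.deriv_eq, (hcomp hcd2 k).deriv, hx0] at h
    simpa [hN.christoffel_eq_zero] using h
  have h3 := HasDerivAt.fun_sum fun i (_ : i ∈ Finset.univ) => (hcomp hcd2 i).fun_mul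
    (hasDerivAt_comp_eq_sum (hF.partialDeriv i).differentiableAt hcd.self_of_nhds)
  rw [e2.deriv_eq, HasDerivAt.deriv h3]
  -- What remains of the second derivative is the Euclidean Hessian on the velocity, which is the
  -- Ricci form there.
  have h4 := ricci_nonneg hN.eq_one (hpos φ hφ 0 h0) (deriv c t)
  simp_rw [hf.ricci_eq φ hφ 0 h0, hN.hessian_eq] at h4
  refine h4.trans_eq ?_
  simp only [hgeo', zero_mul, zero_add, Finset.mul_sum, hct]
  rw [Finset.sum_comm]
  exact Finset.sum_congr rfl fun i _ => Finset.sum_congr rfl fun j _ => by ring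

/-- The angle estimate: convexity of the potential along a minimizing geodesic. -/
theorem IsGradientRicciSoliton.div_dist_le {γ : ℝ → M} {p q : M} (hpq : p ≠ q)
    (hγ : IsMinimizingGeodesic n γ p q) :
    (f q - f p) / dist p q ≤ ‖grad n f q‖ * Real.cos (normalAngle n f γ (dist p q)) := by
  set s := dist p q with hs
  have hs0 : 0 < s := dist_pos.2 hpq
  have hq : γ s = q := hγ.target
  have hsm : ∀ t ∈ Set.Icc 0 s, ContDiffAt ℝ ∞ (fun τ => f (γ τ)) t := fun t ht =>
    contMDiffAt_iff_contDiffAt.1 ((hf.smooth _).comp t (hγ.smooth t ht))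
  have hd : ∀ t ∈ Set.Icc 0 s, DifferentiableAt ℝ (fun τ => f (γ τ)) t := fun t ht =>
    (hsm t ht).differentiableAt (by simp)
  have hd2 : ∀ t ∈ Set.Icc 0 s, DifferentiableAt ℝ (deriv fun τ => f (γ τ)) t := fun t ht =>
    (ContDiffAt.derivWithin (m := ∞) (hsm t ht) (by simp)).differentiableAt (by simp)
  have hmono : MonotoneOn (deriv fun τ => f (γ τ)) (Set.Icc 0 s) := by
    refine monotoneOn_of_deriv_nonneg (convex_Icc 0 s)
      (fun t ht => (hd2 t ht).continuousAt.continuousWithinAt)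
      (fun t ht => (hd2 t (interior_subset ht)).differentiableWithinAt) fun t ht => ?_
    exact hf.deriv_deriv_comp_geodesic_nonneg hpos (hγ.smooth t (interior_subset ht))
      (hγ.geodesic t (interior_subset ht))
  -- The mean slope is attained at some interior `t`; by monotonicity it is at most the slope at
  -- `s`.
  obtain ⟨t, ht, htd⟩ := exists_deriv_eq_slope (fun τ => f (γ τ)) hs0
    (fun t ht => (hd t ht).continuousAt.continuousWithinAt)
    (fun t ht => (hd t (Set.Ioo_subset_Icc_self ht)).differentiableWithinAt)
  have hsI : s ∈ Set.Icc 0 s := Set.right_mem_Icc.2 hs0.le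
  have h1 := hmono (Set.Ioo_subset_Icc_self ht) hsI ht.2.le
  have h2 := ((hγ.smooth s hsI).mdifferentiableAt (by simp)).hasMFDerivAt
  have h3 : HasDerivAt (fun τ => f (γ τ)) (inner ℝ (grad n f (γ s)) (velocity n γ s)) s := by
    refine hasDerivAt_comp_of_hasMFDerivAt hf.smooth (h2.congr_mfderiv ?_)
    ext
    change _ = (1 : ℝ) • velocity n γ s
    rw [one_smul]
    rfl
  rw [htd, h3.deriv, ← norm_grad_mul_cos_normalAngle (hγ.unit_speed s hsI), hγ.source, hq,
    sub_zero] at h1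
  exact h1

end Curves

/-! ### Growth of the gradient and length along level curves. -/

section LevelCurves

variable {n : ℕ} {M : Type*} [MetricSpace M] [ChartedSpace (EuclideanSpace ℝ (Fin n)) M]
  {f : M → ℝ} {φ : OpenPartialHomeomorph M (EuclideanSpace ℝ (Fin n))}
  [RiemannianBundle (fun x : M => TangentSpace (𝓡 n) x)] {Γ : ℝ → M}
  (hΓ : IsLevelCurve n f Γ) {l : ℝ} (hl : 0 < l)
include hΓ hl

theorem IsLevelCurve.hasMFDerivAt :
    HasMFDerivAt 𝓘(ℝ, ℝ) (𝓡 n) Γ l ((1 : ℝ →L[ℝ] ℝ).smulRight (levelField n f (Γ l))) :=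
  (hΓ.integral l hl).hasMFDerivAt (Ioi_mem_nhds hl)

/-- Since `f (Γ l) = l`, the derivative of `f` along `Γ` is `1`; at a critical point it would be
`0`. -/
theorem IsLevelCurve.grad_ne_zero (hf : ContMDiff (𝓡 n) 𝓘(ℝ, ℝ) ∞ f) :
    grad n f (Γ l) ≠ 0 := by
  intro h0
  have h1 := hasDerivAt_comp_of_hasMFDerivAt hf (hΓ.hasMFDerivAt hl)
  have h2 : HasDerivAt (fun τ => f (Γ τ)) 1 l := by
    refine (hasDerivAt_id l).congr_of_eventuallyEq ?_
    filter_upwards [Ioi_mem_nhds hl] with τ hτ using hΓ.level τ hτ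
  have h3 := h1.unique h2
  rw [h0, inner_zero_left] at h3
  exact zero_ne_one h3

theorem IsLevelCurve.norm_grad_pos (hf : ContMDiff (𝓡 n) 𝓘(ℝ, ℝ) ∞ f) :
    0 < ‖grad n f (Γ l)‖ :=
  norm_pos_iff.2 (hΓ.grad_ne_zero hl hf)

variable [IsManifold (𝓡 n) ∞ M]
  [IsContMDiffRiemannianBundle (𝓡 n) ∞ (EuclideanSpace ℝ (Fin n))
      (fun x : M => TangentSpace (𝓡 n) x)]

theorem IsLevelCurve.hasDerivAt_chart_comp (hf : ContMDiff (𝓡 n) 𝓘(ℝ, ℝ) ∞ f)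
    (hφ : φ ∈ IsManifold.maximalAtlas (𝓡 n) ∞ M) (hx : Γ l ∈ φ.source) :
    HasDerivAt (fun τ => φ (Γ τ)) ((‖grad n f (Γ l)‖ ^ 2)⁻¹ •
      gradVec (metricCoeff φ) (fun z => f (φ.symm z)) (φ (Γ l))) l := by
  refine (RicciSoliton.hasDerivAt_chart_comp hφ hx (hΓ.hasMFDerivAt hl)).congr_deriv ?_
  rw [← mfderiv_chart_grad hφ hf hx, levelField]
  exact map_smul _ _ _

/-- An integral curve is a priori only differentiable; its velocity is a continuous field along a
continuous curve, so it is `C¹`. This regularity is needed to compare Riemannian distance with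
length. -/
theorem IsLevelCurve.contMDiffAt (hf : ContMDiff (𝓡 n) 𝓘(ℝ, ℝ) ∞ f) :
    ContMDiffAt 𝓘(ℝ, ℝ) (𝓡 n) 1 Γ l := by
  set φ := chartAt (EuclideanSpace ℝ (Fin n)) (Γ l)
  have hφ : φ ∈ IsManifold.maximalAtlas (𝓡 n) ∞ M := IsManifold.chart_mem_maximalAtlas (Γ l)
  have hx : Γ l ∈ φ.source := mem_chart_source _ _
  have hcont : ∀ τ, 0 < τ → ContinuousAt Γ τ := fun τ hτ => (hΓ.hasMFDerivAt hτ).continuousAt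
  have : IsManifold (𝓡 n) 1 M := IsManifold.of_le (n := ∞) (by simp)
  refine (contMDiffAt_iff_target_of_mem_source hx).2 ⟨hcont l hl, ?_⟩
  refine contMDiffAt_iff_contDiffAt.2 ?_
  set F : EuclideanSpace ℝ (Fin n) → ℝ := fun z => f (φ.symm z)
  set G := metricCoeff (n := n) φ
  set u : Set ℝ := {τ | 0 < τ ∧ Γ τ ∈ φ.source}
  have hu : u ∈ nhds l := Filter.Eventually.and (Ioi_mem_nhds hl)
    ((hcont l hl).eventually (φ.open_source.mem_nhds hx))
  -- The coordinate expression of `∇f / |∇f|²`.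
  set V : EuclideanSpace ℝ (Fin n) → EuclideanSpace ℝ (Fin n) := fun z =>
    (∑ i, ∑ j, (G z)⁻¹ i j * (partialDeriv i F z * partialDeriv j F z))⁻¹ • gradVec G F z
  have hVc : ∀ τ ∈ u, ContinuousAt V (φ (Γ τ)) := by
    rintro τ ⟨hτ, hτs⟩
    have hy := φ.map_source hτs
    have hG := isMetricNear_metricCoeff hφ hy
    have hGi := smoothNear_inv hG.smooth hG.det_ne_zero
    have hF := smoothNear_comp_chart_symm hf hφ hy
    have hQ : SmoothNear (fun z => ∑ i, ∑ j,
        (G z)⁻¹ i j * (partialDeriv i F z * partialDeriv j F z)) (φ (Γ τ)) :=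
      SmoothNear.sum fun i _ => SmoothNear.sum fun j _ =>
        (hGi i j).mul ((hF.partialDeriv i).mul (hF.partialDeriv j))
    have hQ0 : ∑ i, ∑ j, (G (φ (Γ τ)))⁻¹ i j *
        (partialDeriv i F (φ (Γ τ)) * partialDeriv j F (φ (Γ τ))) ≠ 0 := by
      rw [← norm_grad_sq hφ hf hτs]
      exact pow_ne_zero 2 (hΓ.norm_grad_pos hτ hf).ne'
    refine (hQ.self.continuousAt.inv₀ hQ0).smul ?_
    refine (PiLp.continuous_toLp 2 _).continuousAt.comp (continuousAt_pi.2 fun i => ?_)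
    exact (SmoothNear.sum fun j _ => (hGi i j).mul (hF.partialDeriv j)).self.continuousAt
  refine contDiffAt_one_iff.2 ⟨fun τ => (1 : ℝ →L[ℝ] ℝ).smulRight (V (φ (Γ τ))), u, hu, ?_, ?_⟩
  · intro τ hτ
    refine ContinuousAt.continuousWithinAt ?_
    have h1 : ContinuousAt (fun τ => V (φ (Γ τ))) τ :=
      ContinuousAt.comp (f := fun τ => φ (Γ τ)) (hVc τ hτ)
        (ContinuousAt.comp (φ.continuousAt hτ.2) (hcont τ hτ.1))
    exact ((ContinuousLinearMap.smulRightL ℝ ℝ (EuclideanSpace ℝ (Fin n))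
      (1 : ℝ →L[ℝ] ℝ)).continuous.continuousAt).comp h1
  · intro τ hτ
    have h1 := hΓ.hasDerivAt_chart_comp hτ.1 hf hφ hτ.2
    rw [norm_grad_sq hφ hf hτ.2] at h1
    exact h1.hasFDerivAt

omit hl in
/-- The length of a level curve is controlled by a lower bound of the gradient. -/
theorem IsLevelCurve.dist_le [IsRiemannianManifold (𝓡 n) M] (hf : ContMDiff (𝓡 n) 𝓘(ℝ, ℝ) ∞ f)
    {a b κ : ℝ} (ha : 0 < a) (hab : a ≤ b) (hκ : 0 < κ)
    (hg : ∀ t ∈ Set.Icc a b, κ ≤ ‖grad n f (Γ t)‖) : dist (Γ a) (Γ b) ≤ (b - a) / κ := by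
  have h1 : ContMDiffOn 𝓘(ℝ, ℝ) (𝓡 n) 1 Γ (Set.Icc a b) := fun t ht =>
    (hΓ.contMDiffAt (ha.trans_le ht.1) hf).contMDiffWithinAt
  have h2 := Manifold.riemannianEDist_le_pathELength h1 rfl rfl hab
  rw [← IsRiemannianManifold.out, Manifold.pathELength_eq_lintegral_mfderiv_Icc] at h2
  -- The speed of `Γ` is `1 / |∇f|`, at most `1 / κ`.
  have h3 : ∫⁻ t in Set.Icc a b, ‖mfderiv 𝓘(ℝ, ℝ) (𝓡 n) Γ t 1‖ₑ
      ≤ ∫⁻ _ in Set.Icc a b, ENNReal.ofReal κ⁻¹ := by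
    refine MeasureTheory.setLIntegral_mono measurable_const fun t ht => ?_
    have ht0 := ha.trans_le ht.1
    have e : mfderiv 𝓘(ℝ, ℝ) (𝓡 n) Γ t 1 = levelField n f (Γ t) := by
      rw [(hΓ.hasMFDerivAt ht0).mfderiv]
      change (1 : ℝ) • levelField n f (Γ t) = _
      rw [one_smul]
    rw [e, ← ofReal_norm]
    refine ENNReal.ofReal_le_ofReal ?_
    have hp := hΓ.norm_grad_pos ht0 hf
    rw [levelField, norm_smul, norm_inv, norm_pow, norm_norm, pow_two, mul_inv, mul_assoc,
      inv_mul_cancel₀ hp.ne', mul_one]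
    exact inv_anti₀ hκ (hg t ht)
  have h4 := h2.trans h3
  rw [MeasureTheory.setLIntegral_const, Real.volume_Icc, ← ENNReal.ofReal_mul (by positivity),
    edist_dist, ENNReal.ofReal_le_ofReal_iff (mul_nonneg (by positivity) (by linarith))] at h4
  rwa [div_eq_inv_mul]

variable (hf : IsGradientRicciSoliton n f) (hpos : HasPositiveSectionalCurvature n M)
include hf hpos

/-- Along a level curve of a soliton the gradient grows and `R + |∇f|²` is stationary. -/
theorem IsLevelCurve.exists_hasDerivAt : ∃ d : ℝ, 0 ≤ d ∧
    HasDerivAt (fun τ => ‖grad n f (Γ τ)‖ ^ 2) d l ∧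
    HasDerivAt (fun τ => scalarCurvature n (Γ τ)) (-d) l := by
  obtain ⟨φ, hφ, hx, hx0, hN⟩ := exists_normal_chart (n := n) (Γ l)
  have h0 : (0 : EuclideanSpace ℝ (Fin n)) ∈ φ.target := hx0 ▸ φ.map_source hx
  set F : EuclideanSpace ℝ (Fin n) → ℝ := fun z => f (φ.symm z)
  have hF : SmoothNear F 0 := smoothNear_comp_chart_symm hf.smooth hφ h0
  have hc := hΓ.hasDerivAt_chart_comp hl hf.smooth hφ hx
  set a := (‖grad n f (Γ l)‖ ^ 2)⁻¹
  have ha0 : 0 ≤ a := by positivity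
  have hnear : ∀ᶠ τ in nhds l, Γ τ ∈ φ.source :=
    (hΓ.hasMFDerivAt hl).continuousAt.eventually (φ.open_source.mem_nhds hx)
  have hw : ∀ i, gradVec (metricCoeff φ) F 0 i = partialDeriv i F 0 := by
    intro i
    simp [gradVec, hN.inv_eq_one, Matrix.one_apply]
  rw [hx0] at hc
  change HasDerivAt _ (a • gradVec (metricCoeff φ) F 0) l at hc
  have hQ : SmoothNear (fun z => ∑ i, ∑ j,
      (metricCoeff φ z)⁻¹ i j * (partialDeriv i F z * partialDeriv j F z)) 0 :=
    SmoothNear.sum fun i _ => SmoothNear.sum fun j _ =>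
      (hN.smooth_inv i j).mul ((hF.partialDeriv i).mul (hF.partialDeriv j))
  have hS : SmoothNear (scalar (metricCoeff φ)) 0 := smoothNear_scalar hN.smooth hN.det_ne_zero
  rw [← hx0] at hQ hS
  have d1 := hasDerivAt_comp_eq_sum hQ.differentiableAt hc
  have d2 := hasDerivAt_comp_eq_sum hS.differentiableAt hc
  have e1 : (fun τ => ‖grad n f (Γ τ)‖ ^ 2) =ᶠ[nhds l] fun τ => ∑ i, ∑ j,
      (metricCoeff φ (φ (Γ τ)))⁻¹ i j * (partialDeriv i F (φ (Γ τ)) *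
        partialDeriv j F (φ (Γ τ))) :=
    hnear.mono fun τ hτ => norm_grad_sq hφ hf.smooth hτ
  have e2 : (fun τ => scalarCurvature n (Γ τ)) =ᶠ[nhds l]
      fun τ => scalar (metricCoeff φ) (φ (Γ τ)) :=
    hnear.mono fun τ hτ => hf.scalarCurvature_eq hφ hτ
  have hric := ricci_nonneg hN.eq_one (hpos φ hφ 0 h0) (gradVec (metricCoeff φ) F 0)
  have hsol : ∀ᶠ z in nhds (0 : EuclideanSpace ℝ (Fin n)), ∀ i j,
      ricci (metricCoeff φ) i j z = hessian (metricCoeff φ) F i j z := by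
    filter_upwards [φ.open_target.mem_nhds h0] with z hz i j using hf.ricci_eq φ hφ z hz i j
  -- The common rate is `2 Ric (∇f, ∇f) / |∇f|²`, with `a = |∇f|⁻²`.
  refine ⟨2 * a * ∑ j, ∑ k, ricci (metricCoeff φ) j k 0 * gradVec (metricCoeff φ) F 0 j
    * gradVec (metricCoeff φ) F 0 k, by positivity,
    (d1.congr_of_eventuallyEq e1).congr_deriv ?_, (d2.congr_of_eventuallyEq e2).congr_deriv ?_⟩
  · rw [hx0, Finset.mul_sum]
    refine Finset.sum_congr rfl fun m _ => ?_
    rw [hN.partialDeriv_gradSq hF]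
    simp only [PiLp.smul_apply, smul_eq_mul, hw, Finset.mul_sum, ← hsol.self_of_nhds]
    exact Finset.sum_congr rfl fun k _ => by ring
  · rw [hx0, Finset.mul_sum, ← Finset.sum_neg_distrib]
    refine Finset.sum_congr rfl fun m _ => ?_
    rw [hN.partialDeriv_scalar_of_soliton hF hsol]
    simp only [PiLp.smul_apply, smul_eq_mul, hw, Finset.mul_sum, ← Finset.sum_neg_distrib]
    exact Finset.sum_congr rfl fun k _ => by ring

omit hl in
theorem IsLevelCurve.monotoneOn_norm_grad :
    MonotoneOn (fun τ => ‖grad n f (Γ τ)‖) (Set.Ioi 0) := by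
  have h : MonotoneOn (fun τ => ‖grad n f (Γ τ)‖ ^ 2) (Set.Ioi 0) := by
    refine monotoneOn_of_deriv_nonneg (convex_Ioi 0) (fun t ht => ?_) (fun t ht => ?_)
      fun t ht => ?_
    · obtain ⟨d, -, h, -⟩ := hΓ.exists_hasDerivAt ht hf hpos
      exact h.continuousAt.continuousWithinAt
    · obtain ⟨d, -, h, -⟩ := hΓ.exists_hasDerivAt (interior_subset ht) hf hpos
      exact h.differentiableAt.differentiableWithinAt
    · obtain ⟨d, hd, h, -⟩ := hΓ.exists_hasDerivAt (interior_subset ht) hf hpos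
      rwa [h.deriv]
  intro s hs t ht hst
  exact (pow_le_pow_iff_left₀ (norm_nonneg _) (norm_nonneg _) two_ne_zero).1 (h hs ht hst)

/-- The gradient of the potential is bounded along level curves. -/
theorem IsLevelCurve.norm_grad_sq_le : ‖grad n f (Γ l)‖ ^ 2
    ≤ scalarCurvature n (Γ 1) + ‖grad n f (Γ 1)‖ ^ 2 := by
  have hd : ∀ t : ℝ, 0 < t →
      HasDerivAt (fun τ => scalarCurvature n (Γ τ) + ‖grad n f (Γ τ)‖ ^ 2) 0 t := by
    intro t ht
    obtain ⟨d, -, h1, h2⟩ := hΓ.exists_hasDerivAt ht hf hpos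
    exact (h2.add h1).congr_deriv (by ring)
  -- The sum is constant on the half-line; the reference point `1` is arbitrary. Dropping `R ≥ 0` on
  -- the left gives the bound.
  have h : scalarCurvature n (Γ l) + ‖grad n f (Γ l)‖ ^ 2
      = scalarCurvature n (Γ 1) + ‖grad n f (Γ 1)‖ ^ 2 := isOpen_Ioi.is_const_of_deriv_eq_zero isPreconnected_Ioi
    (fun t ht => (hd t ht).differentiableAt.differentiableWithinAt)
    (fun t ht => (hd t ht).deriv) hl (Set.mem_Ioi.2 one_pos)
  have := hf.scalarCurvature_nonneg hpos (Γ l)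
  linarith

omit hl in
theorem IsLevelCurve.exists_tendsto_norm_grad : ∃ ζ : ℝ, 0 < ζ ∧
    Filter.Tendsto (fun l => ‖grad n f (Γ l)‖) Filter.atTop (nhds ζ) ∧
    ∀ l, 0 < l → ‖grad n f (Γ l)‖ ≤ ζ := by
  have hmono := hΓ.monotoneOn_norm_grad hf hpos
  -- Nothing is known about `Γ` on `(-∞, 0]`; truncating at `1` gives a function monotone on all of
  -- `ℝ` with the same limit.
  set p : ℝ → ℝ := fun l => ‖grad n f (Γ (max l 1))‖ with hp
  have hpm : Monotone p := fun s t hst => hmono (Set.mem_Ioi.2 (by positivity))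
    (Set.mem_Ioi.2 (by positivity)) (max_le_max_right 1 hst)
  have hbdd : BddAbove (Set.range p) := by
    refine ⟨√(scalarCurvature n (Γ 1) + ‖grad n f (Γ 1)‖ ^ 2), ?_⟩
    rintro _ ⟨l, rfl⟩
    exact Real.le_sqrt_of_sq_le (hΓ.norm_grad_sq_le (by positivity) hf hpos)
  have hle : ∀ l, 0 < l → ‖grad n f (Γ l)‖ ≤ ⨆ l, p l := fun l hl =>
    (hmono hl (Set.mem_Ioi.2 (by positivity)) (le_max_left l 1)).trans (le_ciSup hbdd l)
  refine ⟨⨆ l, p l, (hΓ.norm_grad_pos one_pos hf.smooth).trans_le (hle 1 one_pos), ?_, hle⟩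
  refine (tendsto_atTop_ciSup hpm hbdd).congr' ?_
  filter_upwards [Filter.eventually_ge_atTop 1] with l hl
  change ‖grad n f (Γ (max l 1))‖ = _
  rw [max_eq_left hl]

end LevelCurves

end RicciSoliton

end

/-! ### The angle estimates. -/

theorem theorem3p1 {n : ℕ} {M : Type*} [MetricSpace M]
    [ChartedSpace (EuclideanSpace ℝ (Fin n)) M] [IsManifold (𝓡 n) ∞ M]
    [RiemannianBundle (fun x : M => TangentSpace (𝓡 n) x)]
    [IsContMDiffRiemannianBundle (𝓡 n) ∞ (EuclideanSpace ℝ (Fin n))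
      (fun x : M => TangentSpace (𝓡 n) x)]
    [IsRiemannianManifold (𝓡 n) M]
    (f : M → ℝ) (hf : RicciSoliton.IsGradientRicciSoliton n f)
    (hpos : RicciSoliton.HasPositiveSectionalCurvature n M)
    (O : M) (hmax : ∀ x : M, RicciSoliton.scalarCurvature n x ≤ RicciSoliton.scalarCurvature n O)
    (hone : RicciSoliton.scalarCurvature n O = 1) (hfO : f O = 0)
    (Γ : ℝ → M) (hΓ : RicciSoliton.IsLevelCurve n f Γ) :
    (∀ l : ℝ, 0 < l → ∀ γ : ℝ → M, RicciSoliton.IsMinimizingGeodesic n γ O (Γ l) →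
      (f (Γ l) - f O) / dist O (Γ l) ≤
        ‖RicciSoliton.grad n f (Γ l)‖
          * Real.cos (RicciSoliton.normalAngle n f γ (dist O (Γ l)))) ∧
    ∃ ζ : ℝ, 0 < ζ ∧
      Filter.Tendsto (fun l : ℝ => ‖RicciSoliton.grad n f (Γ l)‖) Filter.atTop (nhds ζ) ∧
      ∀ ε : ℝ, 0 < ε → ∃ Λ : ℝ, 0 < Λ ∧ ∀ l : ℝ, Λ ≤ l →
        ∀ γ : ℝ → M, RicciSoliton.IsMinimizingGeodesic n γ O (Γ l) →
          (ζ - ε) / ζ ≤ Real.cos (RicciSoliton.normalAngle n f γ (dist O (Γ l))) := by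
  have hne : ∀ l : ℝ, 0 < l → O ≠ Γ l := by
    rintro l hl h
    have := hΓ.level l hl
    rw [← h, hfO] at this
    exact hl.ne this
  have angle : ∀ l : ℝ, 0 < l → ∀ γ : ℝ → M, RicciSoliton.IsMinimizingGeodesic n γ O (Γ l) →
      (f (Γ l) - f O) / dist O (Γ l) ≤ ‖RicciSoliton.grad n f (Γ l)‖
        * Real.cos (RicciSoliton.normalAngle n f γ (dist O (Γ l))) :=
    fun l hl γ hγ => hf.div_dist_le hpos (hne l hl) hγ
  refine ⟨angle, ?_⟩
  obtain ⟨ζ, hζ, hlim, hle⟩ := hΓ.exists_tendsto_norm_grad hf hpos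
  refine ⟨ζ, hζ, hlim, fun ε hε => ?_⟩
  -- The bound `ζ - ε / 2` leaves half of `ε` to spare; `ζ / 2` keeps `κ` positive when `ε` is
  -- large.
  have hκζ : max (ζ - ε / 2) (ζ / 2) < ζ := max_lt (by linarith) (by linarith)
  obtain ⟨a, hga, ha⟩ := ((hlim.eventually_const_lt hκζ).and
    (Filter.eventually_ge_atTop 1)).exists
  set κ := max (ζ - ε / 2) (ζ / 2)
  have hκ1 : ζ - ε / 2 ≤ κ := le_max_left _ _
  have hκ : 0 < κ := (half_pos hζ).trans_le (le_max_right _ _)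
  have ha0 : 0 < a := one_pos.trans_le ha
  set D := dist O (Γ a)
  have hD : 0 ≤ D := dist_nonneg
  -- Beyond this threshold `ε l / 2` absorbs `ζ² D`, the cost of first travelling from `O` to `Γ a`.
  refine ⟨max a (2 * ζ * D * ζ / ε), ha0.trans_le (le_max_left _ _), fun l hl γ hγ => ?_⟩
  have hal : a ≤ l := (le_max_left _ _).trans hl
  have hl0 : 0 < l := ha0.trans_le hal
  have hlD : 2 * ζ * D * ζ ≤ ε * l := by
    have := (le_max_right _ _).trans hl
    rwa [div_le_iff₀ hε, mul_comm l] at this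
  set s := dist O (Γ l)
  have hs : 0 < s := dist_pos.2 (hne l hl0)
  set C := Real.cos (RicciSoliton.normalAngle n f γ s)
  set g := ‖RicciSoliton.grad n f (Γ l)‖
  have hg : 0 < g := hΓ.norm_grad_pos hl0 hf.smooth
  have hsle : s * κ ≤ D * κ + l := by
    have h1 := hΓ.dist_le hf.smooth ha0 hal hκ fun t ht => hga.le.trans
      (hΓ.monotoneOn_norm_grad hf hpos ha0 (ha0.trans_le ht.1) ht.1)
    have h2 : s ≤ D + (l - a) / κ := (dist_triangle O (Γ a) (Γ l)).trans (by gcongr)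
    calc s * κ ≤ (D + (l - a) / κ) * κ := by gcongr
      _ = D * κ + (l - a) := by field_simp
      _ ≤ D * κ + l := by linarith
  have hC : l ≤ s * (g * C) := by
    have := angle l hl0 γ hγ
    rw [hΓ.level l hl0, hfO, sub_zero, div_le_iff₀ hs] at this
    linarith
  -- Positivity of the cosine permits replacing `|∇f|` by `ζ` below, and settles the case `ζ ≤ ε`.
  have hC0 : 0 < C := by
    by_contra h
    have := mul_nonpos_of_nonneg_of_nonpos (mul_pos hs hg).le (not_lt.1 h)
    linarith
  rw [div_le_iff₀ hζ]
  rcases le_or_gt (ζ - ε) 0 with h0 | h0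
  · exact h0.trans (by positivity)
  have hsζ : l ≤ s * (C * ζ) := hC.trans (by
    have := hle l hl0
    rw [mul_comm C ζ]
    gcongr)
  -- By `hsle` the left side is at most `ζ² D + (ζ - ε) l`, and `l κ - (ζ - ε) l ≥ ε l / 2 ≥ ζ² D`.
  have key : (ζ - ε) * s * κ ≤ l * κ := by
    have h1 : (ζ - ε) * (D * κ) ≤ ζ * (D * ζ) := by
      gcongr
      linarith
    nlinarith [mul_le_mul_of_nonneg_left hsle h0.le]
  have key2 : (ζ - ε) * s ≤ l := le_of_mul_le_mul_right key hκ
  have : (ζ - ε) * s ≤ (C * ζ) * s := by linarith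
  exact le_of_mul_le_mul_right this hs
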